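/- Let $N>8$, $\alpha>0$ and $\beta>(\alpha-2)^+=\max(\alpha-2,0)$. On $\mathbb{R}^N$ put $a(x)=1+|x|^{\alpha}$, $V(x)=|x|^{\beta}$ and $Au=a^{2}\Delta^{2}u+V^{2}u$. For complex-valued $u$ with weak derivatives up to order $4$ let $|D^{k}u|=\big(\sum_{i_1,\dots,i_k=1}^{N}|D_{i_1\cdots i_k}u|^{2}\big)^{1/2}$ for $k=1,2,3,4$, and $|D^{0}u|=|u|$. Let $$D_{2}(A)=\{u\in H^{4}(\mathbb{R}^{N}) : V^{2}u\in L^{2}(\mathbb{R}^{N}),\ |x|^{2\alpha-h}|D^{4-h}u|\in L^{2}(\mathbb{R}^{N})\text{ for }h=0,1,2,3,4\}.$$ Then $C_{c}^{\infty}(\mathbb{R}^{N}\setminus\{0\})\subset D_2(A)$, $Au\in L^2(\mathbb{R}^N)$ for every $u\in D_2(A)$, and $C_{c}^{\infty}(\mathbb{R}^{N}\setminus\{0\})$ is dense in $D_{2}(A)$ with respect to the graph norm $\|Au\|_2+\|u\|_2$. Moreover, there exists a constant $C\ge 0$, depending only on $N,\alpha,\beta$, such that for every $u\in D_{2}(A)$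 $$\||x|^{2\alpha-h}D^{4-h}u\|_{2}\le C\left(\|Au\|_{2}+\|u\|_{2}\right)\quad\text{for }h=0,1,2,3,4,\qquad \|V^{2}u\|_{2}\le C\left(\|Au\|_{2}+\|u\|_{2}\right).$$ -/

import Mathlib

open MeasureTheory TemperedDistribution
open scoped SchwartzMap LineDeriv Laplacian ENNReal NNReal ContDiff

noncomputable section

/-- The complex Hilbert space `L²(ℝ^N)`, with Lebesgue measure. -/
abbrev LTwo (N : ℕ) : Type :=
  Lp ℂ 2 (volume : Measure (EuclideanSpace ℝ (Fin N)))

/-- The tempered distribution given by an `L²` function. -/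
abbrev LTwo.toDistr {N : ℕ} (u : LTwo N) : 𝓢'(EuclideanSpace ℝ (Fin N), ℂ) :=
  Lp.toTemperedDistribution u

open Classical in
/-- The `L²` function representing a tempered distribution `T`, and `0` if there is none.
It is only used for distributional derivatives of order at most four of functions in `H⁴`,
where it exists (`distrib_deriv_repr`, `bilaplacian_repr`) and is unique (`lTwoRepr_toDistr`). -/
def lTwoRepr {N : ℕ} (T : 𝓢'(EuclideanSpace ℝ (Fin N), ℂ)) : LTwo N :=
  if h : ∃ g : LTwo N, T = g.toDistr then h.choose else 0

theorem LTwo.toDistr_injective {N : ℕ} :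
    Function.Injective (LTwo.toDistr : LTwo N → 𝓢'(EuclideanSpace ℝ (Fin N), ℂ)) := by
  intro u v h
  have hk := Lp.ker_toTemperedDistributionCLM_eq_bot (E := EuclideanSpace ℝ (Fin N))
    (F := ℂ) (μ := volume) (p := 2)
  exact LinearMap.ker_eq_bot.mp hk h

theorem lTwoRepr_toDistr {N : ℕ} (g : LTwo N) : lTwoRepr g.toDistr = g := by
  have h : ∃ g' : LTwo N, g.toDistr = g'.toDistr := ⟨g, rfl⟩
  rw [lTwoRepr, dif_pos h]
  exact (LTwo.toDistr_injective h.choose_spec).symm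

theorem toDistr_lTwoRepr {N : ℕ} {T : 𝓢'(EuclideanSpace ℝ (Fin N), ℂ)}
    (hT : MemSobolev 0 2 T) : (lTwoRepr T).toDistr = T := by
  have h : ∃ g : LTwo N, T = g.toDistr := memSobolev_zero_iff.mp hT
  rw [lTwoRepr, dif_pos h]
  exact h.choose_spec.symm

/-- The partial derivative `D_{m 0} ⋯ D_{m (k-1)} T` in the sense of distributions. -/
abbrev distribPartial {N k : ℕ} (m : Fin k → Fin N)
    (T : 𝓢'(EuclideanSpace ℝ (Fin N), ℂ)) : 𝓢'(EuclideanSpace ℝ (Fin N), ℂ) :=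
  ∂^{fun j => EuclideanSpace.single (m j) (1 : ℝ)} T

theorem memSobolev_distribPartial {N k : ℕ} (m : Fin k → Fin N)
    {T : 𝓢'(EuclideanSpace ℝ (Fin N), ℂ)} {s : ℝ} (hT : MemSobolev s 2 T) :
    MemSobolev (s - k) 2 (distribPartial m T) := by
  induction k with
  | zero => simpa using hT
  | succ k ih =>
    have h := (ih (fun j => m j.succ)).lineDerivOp
      (m := EuclideanSpace.single (m 0) (1 : ℝ))
    have e : s - ((k + 1 : ℕ) : ℝ) = s - k - 1 := by push_cast; ring
    rw [e]
    exact h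

/-- For `u ∈ H⁴` the derivatives of order at most four are `L²` functions. -/
theorem distrib_deriv_repr {N k : ℕ} (hk : k ≤ 4) (m : Fin k → Fin N) {u : LTwo N}
    (hu : MemSobolev 4 2 u.toDistr) :
    (lTwoRepr (distribPartial m u.toDistr)).toDistr = distribPartial m u.toDistr := by
  apply toDistr_lTwoRepr
  refine (memSobolev_distribPartial m hu).mono ?_
  have : (k : ℝ) ≤ 4 := by exact_mod_cast hk
  linarith

/-- For `u ∈ H⁴` the bi-Laplacian is an `L²` function. -/
theorem bilaplacian_repr {N : ℕ} {u : LTwo N} (hu : MemSobolev 4 2 u.toDistr) :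
    (lTwoRepr (Δ (Δ u.toDistr))).toDistr = Δ (Δ u.toDistr) := by
  apply toDistr_lTwoRepr
  refine hu.laplacian.laplacian.mono ?_
  norm_num

/-- The pointwise size of the tensor of weak derivatives of order `k`,
`|D^k u| = (∑_{i₁,…,i_k} |D_{i₁⋯i_k} u|²)^{1/2}`; for `k = 0` it is `|u|`. -/
def absDeriv {N : ℕ} (k : ℕ) (u : LTwo N) (x : EuclideanSpace ℝ (Fin N)) : ℝ :=
  Real.sqrt (∑ m : Fin k → Fin N, ‖lTwoRepr (distribPartial m u.toDistr) x‖ ^ 2)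

/-- The function `|x|^{2α-h} |D^{4-h} u|`. -/
def weightedDeriv {N : ℕ} (α : ℝ) (h : ℕ) (u : LTwo N) (x : EuclideanSpace ℝ (Fin N)) : ℝ :=
  ‖x‖ ^ (2 * α - h) * absDeriv (4 - h) u x

/-- The diffusion coefficient `a(x) = 1 + |x|^α`. -/
def diffusion {N : ℕ} (α : ℝ) (x : EuclideanSpace ℝ (Fin N)) : ℝ := 1 + ‖x‖ ^ α

/-- The potential `V(x) = |x|^β`. -/
def potential {N : ℕ} (β : ℝ) (x : EuclideanSpace ℝ (Fin N)) : ℝ := ‖x‖ ^ β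

/-- The function `V² u`. -/
def potentialSq {N : ℕ} (β : ℝ) (u : LTwo N) (x : EuclideanSpace ℝ (Fin N)) : ℂ :=
  (potential β x ^ 2 : ℝ) • u x

/-- The operator `A u = a² Δ² u + V² u`, with `Δ²` taken in the sense of distributions. -/
def opA {N : ℕ} (α β : ℝ) (u : LTwo N) (x : EuclideanSpace ℝ (Fin N)) : ℂ :=
  (diffusion α x ^ 2 : ℝ) • lTwoRepr (Δ (Δ u.toDistr)) x + potentialSq β u x

/-- The space `D₂(A)` of all `u ∈ H⁴(ℝ^N)` with `V² u ∈ L²` and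
`|x|^{2α-h} D^{4-h} u ∈ L²` for `h = 0, …, 4`. -/
def domainTwo (N : ℕ) (α β : ℝ) : Set (LTwo N) :=
  {u | MemSobolev 4 2 u.toDistr ∧ MemLp (potentialSq β u) 2 volume ∧
    ∀ h : ℕ, h ≤ 4 → MemLp (weightedDeriv α h u) 2 volume}

/-- `C_c^∞(ℝ^N ∖ {0})`, as a set of elements of `L²(ℝ^N)`. -/
def testFunctions (N : ℕ) : Set (LTwo N) :=
  {u | ∃ φ : EuclideanSpace ℝ (Fin N) → ℂ, ContDiff ℝ ∞ φ ∧ HasCompactSupport φ ∧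
    (0 : EuclideanSpace ℝ (Fin N)) ∉ tsupport φ ∧ u =ᵐ[volume] φ}

/-- The graph norm `‖A u‖₂ + ‖u‖₂` (infinite if `A u ∉ L²`). -/
def graphNorm {N : ℕ} (α β : ℝ) (u : LTwo N) : ℝ≥0∞ :=
  eLpNorm (opA α β u) 2 volume + eLpNorm u 2 volume

end

/-!
The a priori estimates are proved for test functions supported off the origin and then passed to the
domain by density.

For a test function `f`, expand `‖Af‖² = ‖a² Δ² f‖² + ‖V² f‖² + 2 ∫ a² V² ⟨f, Δ² f⟩`
(`opEnergy_eq`). The weight `a² V²` is a sum of powers `|x|^p`, and integration by parts shows that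
`∫ |x|^p ⟨f, Δ² f⟩` is bounded below by `-C ∫ |x|^{p-4} |f|²`
(`exists_neg_le_weightedInner_laplacian_laplacian`). Since `-8 < p - 4 < 4β`, by `β > 0` and
`β > α - 2`, this is at most a small multiple of `‖|x|^{-4} f‖² + ‖V² f‖²` plus `C ‖f‖²`. As `N > 8`,
Hardy's inequality bounds `‖|x|^{-4} f‖` by `‖D⁴ f‖`, hence by `‖Δ² f‖ ≤ ‖a² Δ² f‖`, so the cross
term is absorbed (`exists_separation`). The intermediate derivatives follow from weighted
Calderón–Zygmund estimates, which in `L²` are integrations by parts (`exists_derivEnergy_le`).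

For the density, a function `u` in the domain is approximated by `χₙ ψ`, where `χₙ` is a cutoff with
`|x|^{|a|} |D_a χₙ|` bounded uniformly in `n` and `ψ` is a Schwartz function close to `u` in `H⁴`.
Truncating by `χₙ` produces terms `|x|^{s-|a|} |D_b u|` with `|a| + |b| = |l|`, to which dominated
convergence applies (`tendsto_eLpNorm_cutoff`): for the weights `|x|^{2α-h}` they are part of the
definition of the domain, for the unweighted norm `‖D⁴ u‖` they are square integrable by Hardy's
inequality. For fixed `n` all weights are bounded on the support of `χₙ`, so `H⁴` convergence of `ψ`
suffices (`tendsto_eLpNorm_leibnizSum`). Schwartz functions are dense in `H⁴` because they are dense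
in `L²` and `D_l B^{-4}`, with `B^{-4}` the Bessel potential, is bounded on `L²` for `|l| ≤ 4` by the
closed graph theorem (`exists_schwartz_weakPartial_sub_lt`).
-/

noncomputable section

variable {N : ℕ}

/-! ### Weak derivatives and density of Schwartz functions in `H⁴` -/

/-- The partial derivative of a Schwartz function in the `i`-th coordinate direction. -/
abbrev coordDeriv (i : Fin N) (f : 𝓢(EuclideanSpace ℝ (Fin N), ℂ)) :
    𝓢(EuclideanSpace ℝ (Fin N), ℂ) :=
  ∂_{EuclideanSpace.single i (1 : ℝ)} f

/-- The iterated partial derivative `D_{l₀} D_{l₁} ⋯` of a Schwartz function, along a list of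
coordinates. -/
def schPartial (l : List (Fin N)) (f : 𝓢(EuclideanSpace ℝ (Fin N), ℂ)) :
    𝓢(EuclideanSpace ℝ (Fin N), ℂ) :=
  l.foldr coordDeriv f

/-- The iterated partial derivative `D_{l₀} D_{l₁} ⋯` of a tempered distribution, along a list of
coordinates, as a continuous linear map. -/
def distPartial (l : List (Fin N)) :
    𝓢'(EuclideanSpace ℝ (Fin N), ℂ) →L[ℂ] 𝓢'(EuclideanSpace ℝ (Fin N), ℂ) :=
  l.foldr (fun i L => (LineDeriv.lineDerivOpCLM ℂ _ (EuclideanSpace.single i (1 : ℝ))).comp L)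
    (ContinuousLinearMap.id ℂ _)

/-- The weak partial derivative, along a list of coordinates, of an `L²` function; it is meaningful
for functions in `H⁴` and lists of length at most four. -/
def weakPartial (l : List (Fin N)) (u : LTwo N) : LTwo N :=
  lTwoRepr (distPartial l u.toDistr)

@[simp] theorem schPartial_nil (f : 𝓢(EuclideanSpace ℝ (Fin N), ℂ)) : schPartial [] f = f := rfl

@[simp] theorem schPartial_cons (i : Fin N) (l : List (Fin N))
    (f : 𝓢(EuclideanSpace ℝ (Fin N), ℂ)) :
    schPartial (i :: l) f = coordDeriv i (schPartial l f) := rfl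

@[simp] theorem distPartial_nil (T : 𝓢'(EuclideanSpace ℝ (Fin N), ℂ)) :
    distPartial [] T = T := rfl

@[simp] theorem distPartial_cons (i : Fin N) (l : List (Fin N))
    (T : 𝓢'(EuclideanSpace ℝ (Fin N), ℂ)) :
    distPartial (i :: l) T = ∂_{EuclideanSpace.single i (1 : ℝ)} (distPartial l T) := rfl

theorem distribPartial_eq_distPartial {k : ℕ} (m : Fin k → Fin N)
    (T : 𝓢'(EuclideanSpace ℝ (Fin N), ℂ)) :
    distribPartial m T = distPartial (List.ofFn m) T := by
  induction k with
  | zero => simp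
  | succ k ih =>
    rw [List.ofFn_succ, distPartial_cons, ← ih]
    rfl

theorem memSobolev_distPartial (l : List (Fin N)) {T : 𝓢'(EuclideanSpace ℝ (Fin N), ℂ)} {s : ℝ}
    (hT : MemSobolev s 2 T) : MemSobolev (s - l.length) 2 (distPartial l T) := by
  have h := memSobolev_distribPartial l.get hT
  rwa [distribPartial_eq_distPartial, List.ofFn_get] at h

theorem toDistr_weakPartial {l : List (Fin N)} (hl : l.length ≤ 4) {u : LTwo N}
    (hu : MemSobolev 4 2 u.toDistr) : (weakPartial l u).toDistr = distPartial l u.toDistr := by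
  apply toDistr_lTwoRepr
  refine (memSobolev_distPartial l hu).mono ?_
  have : (l.length : ℝ) ≤ 4 := by exact_mod_cast hl
  linarith

@[simp] theorem weakPartial_nil (u : LTwo N) : weakPartial [] u = u := by
  simp [weakPartial, lTwoRepr_toDistr]

theorem LTwo.toDistr_sub (u v : LTwo N) : (u - v).toDistr = u.toDistr - v.toDistr :=
  map_sub (Lp.toTemperedDistributionCLM ℂ volume 2) u v

theorem weakPartial_sub {l : List (Fin N)} (hl : l.length ≤ 4) {u v : LTwo N}
    (hu : MemSobolev 4 2 u.toDistr) (hv : MemSobolev 4 2 v.toDistr) :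
    weakPartial l (u - v) = weakPartial l u - weakPartial l v := by
  have huv : MemSobolev 4 2 (u - v).toDistr := by
    rw [LTwo.toDistr_sub]; exact hu.sub hv
  apply LTwo.toDistr_injective
  rw [toDistr_weakPartial hl huv, LTwo.toDistr_sub, LTwo.toDistr_sub, toDistr_weakPartial hl hu,
    toDistr_weakPartial hl hv, map_sub]

theorem toDistr_toLp (f : 𝓢(EuclideanSpace ℝ (Fin N), ℂ)) :
    LTwo.toDistr (f.toLp 2) = SchwartzMap.toTemperedDistributionCLM _ ℂ volume f :=
  Lp.toTemperedDistribution_toLp_eq f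

theorem memSobolev_toLp (f : 𝓢(EuclideanSpace ℝ (Fin N), ℂ)) (s : ℝ) :
    MemSobolev s 2 (LTwo.toDistr (f.toLp 2)) := by
  rw [toDistr_toLp]
  exact f.memSobolev

theorem distPartial_toTemperedDistributionCLM (l : List (Fin N))
    (f : 𝓢(EuclideanSpace ℝ (Fin N), ℂ)) :
    distPartial l (SchwartzMap.toTemperedDistributionCLM _ ℂ volume f) =
      SchwartzMap.toTemperedDistributionCLM _ ℂ volume (schPartial l f) := by
  induction l with
  | nil => simp
  | cons i l ih =>
    rw [distPartial_cons, ih, schPartial_cons, lineDerivOp_toTemperedDistributionCLM_eq]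

theorem weakPartial_toLp (l : List (Fin N)) (f : 𝓢(EuclideanSpace ℝ (Fin N), ℂ)) :
    weakPartial l (f.toLp 2) = (schPartial l f).toLp 2 := by
  rw [weakPartial, toDistr_toLp, distPartial_toTemperedDistributionCLM, ← toDistr_toLp,
    lTwoRepr_toDistr]

theorem memSobolev_besselPotential_neg_four (g : LTwo N) :
    MemSobolev 4 2 (besselPotential _ ℂ (-4) g.toDistr) := by
  rw [memSobolev_besselPotential_iff, neg_add_cancel, memSobolev_zero_iff]
  exact ⟨g, rfl⟩

theorem toDistr_lTwoRepr_besselPotential {l : List (Fin N)} (hl : l.length ≤ 4) (g : LTwo N) :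
    (lTwoRepr (distPartial l (besselPotential _ ℂ (-4) g.toDistr))).toDistr =
      distPartial l (besselPotential _ ℂ (-4) g.toDistr) := by
  apply toDistr_lTwoRepr
  refine (memSobolev_distPartial l (memSobolev_besselPotential_neg_four g)).mono ?_
  have : (l.length : ℝ) ≤ 4 := by exact_mod_cast hl
  linarith

/-- The map `g ↦ D_l B^{-4} g` on `L²`, for `l` of length at most four, where `B^{-4}` is the
Bessel potential, so that `H⁴ = B^{-4} L²`. -/
def besselPartial (l : List (Fin N)) (hl : l.length ≤ 4) : LTwo N →ₗ[ℂ] LTwo N where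
  toFun g := lTwoRepr (distPartial l (besselPotential _ ℂ (-4) g.toDistr))
  map_add' g h := by
    apply LTwo.toDistr_injective
    have key : ∀ a b : LTwo N, (a + b).toDistr = a.toDistr + b.toDistr :=
      map_add (Lp.toTemperedDistributionCLM ℂ volume 2)
    rw [toDistr_lTwoRepr_besselPotential hl, key, key, toDistr_lTwoRepr_besselPotential hl,
      toDistr_lTwoRepr_besselPotential hl, map_add, map_add]
  map_smul' c g := by
    apply LTwo.toDistr_injective
    have key : ∀ a : LTwo N, (c • a).toDistr = c • a.toDistr :=
      map_smul (Lp.toTemperedDistributionCLM ℂ volume 2) c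
    rw [RingHom.id_apply, toDistr_lTwoRepr_besselPotential hl, key, key,
      toDistr_lTwoRepr_besselPotential hl, map_smul, map_smul]

/-- Closed graph theorem: the graph is closed since `D_l B^{-4}` is continuous on tempered
distributions, a Hausdorff space into which `L²` embeds continuously. -/
theorem continuous_besselPartial (l : List (Fin N)) (hl : l.length ≤ 4) :
    Continuous (besselPartial l hl) := by
  apply LinearMap.continuous_of_seq_closed_graph
  intro u x y hu hy
  apply LTwo.toDistr_injective
  have hc : Continuous (LTwo.toDistr : LTwo N → _) :=
    (Lp.toTemperedDistributionCLM (E := EuclideanSpace ℝ (Fin N)) ℂ volume 2).continuous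
  have h1 := (hc.tendsto y).comp hy
  have h2 := (((distPartial l).continuous.comp
    ((besselPotential _ ℂ (-4)).continuous.comp hc)).tendsto x).comp hu
  refine tendsto_nhds_unique h1 ?_
  change Filter.Tendsto _ _ (nhds (LTwo.toDistr (lTwoRepr _)))
  rw [toDistr_lTwoRepr_besselPotential hl]
  refine h2.congr fun n => ?_
  exact (toDistr_lTwoRepr_besselPotential hl (u n)).symm

/-- Schwartz functions are dense in `H⁴`. -/
theorem exists_schwartz_weakPartial_sub_lt {u : LTwo N} (hu : MemSobolev 4 2 u.toDistr)
    {ε : ℝ} (hε : 0 < ε) :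
    ∃ ψ : 𝓢(EuclideanSpace ℝ (Fin N), ℂ), ∀ l : List (Fin N), l.length ≤ 4 →
      ‖weakPartial l (u - ψ.toLp 2 volume)‖ < ε := by
  obtain ⟨g, hg⟩ := hu
  have hfin := List.finite_length_le (Fin N) 4
  have hev : ∀ᶠ h in nhds g, ∀ l ∈ {l : List (Fin N) | l.length ≤ 4},
      ‖lTwoRepr (distPartial l (besselPotential _ ℂ (-4) (LTwo.toDistr (g - h))))‖ < ε := by
    rw [Filter.eventually_all_finite hfin]
    intro l hl
    have hc : Continuous fun h => ‖besselPartial l hl (g - h)‖ :=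
      ((continuous_besselPartial l hl).comp (continuous_const.sub continuous_id)).norm
    have h0 := hc.tendsto g
    rw [sub_self, map_zero, norm_zero] at h0
    exact h0.eventually (gt_mem_nhds hε)
  obtain ⟨_, ⟨γ, rfl⟩, hh⟩ :=
    (SchwartzMap.denseRange_toLpCLM (E := EuclideanSpace ℝ (Fin N)) (F := ℂ) (p := 2) (by simp)
      (μ := volume)).inter_nhds_nonempty hev
  obtain ⟨ψ, hψ⟩ : ∃ ψ : 𝓢(EuclideanSpace ℝ (Fin N), ℂ),
      besselPotential _ ℂ (-4) (LTwo.toDistr (γ.toLp 2)) = LTwo.toDistr (ψ.toLp 2) := by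
    refine ⟨SchwartzMap.fourierMultiplierCLM ℂ (fun x ↦ ((1 + ‖x‖ ^ 2) ^ ((-4 : ℝ) / 2) : ℝ)) γ, ?_⟩
    rw [toDistr_toLp, toDistr_toLp, besselPotential,
      fourierMultiplierCLM_toTemperedDistributionCLM_eq (by fun_prop)]
    congr 1
    exact SchwartzMap.fourierMultiplierCLM_ofReal ℂ
      (Function.hasTemperateGrowth_one_add_norm_sq_rpow _ (-4 / 2)) γ
  refine ⟨ψ, fun l hl => ?_⟩
  have e : LTwo.toDistr (u - ψ.toLp 2 volume) =
      besselPotential _ ℂ (-4) (LTwo.toDistr (g - γ.toLp 2 volume)) := by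
    rw [LTwo.toDistr_sub, LTwo.toDistr_sub, map_sub, ← hψ]
    congr 1
    symm
    rw [besselPotential_neg_apply_eq_iff]
    exact hg
  rw [weakPartial, e]
  exact hh l hl

/-! ### Hardy's inequality for Schwartz functions -/

/-- The real inner product of `ℂ`, as a real bilinear map. -/
def realInner : ℂ →L[ℝ] ℂ →L[ℝ] ℝ := innerSL ℝ

@[simp] theorem realInner_apply (a b : ℂ) : realInner a b = inner ℝ a b := rfl

theorem integrable_mul_inner_of_growth {f g : 𝓢(EuclideanSpace ℝ (Fin N), ℂ)}
    {w : EuclideanSpace ℝ (Fin N) → ℝ} (hw : Continuous w) {C : ℝ} {k : ℕ}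
    (hC : ∀ x, |w x| ≤ C * ‖x‖ ^ k) :
    Integrable fun x => w x * inner ℝ (f x) (g x) := by
  have h := ((SchwartzMap.pairing realInner f g).integrable_pow_mul volume k).const_mul C
  refine h.mono' (by fun_prop) (.of_forall fun x => ?_)
  rw [norm_mul, Real.norm_eq_abs]
  calc _ ≤ C * ‖x‖ ^ k * ‖inner ℝ (f x) (g x)‖ := by gcongr; exact hC x
    _ = _ := by rw [SchwartzMap.pairing_apply_apply, realInner_apply, mul_assoc]

/-- Integration by parts in a weighted inner product; the weight need only be differentiable on
the support of `g`. -/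
theorem integral_mul_inner_lineDeriv {f g : 𝓢(EuclideanSpace ℝ (Fin N), ℂ)}
    {w : EuclideanSpace ℝ (Fin N) → ℝ}
    {w' : EuclideanSpace ℝ (Fin N) → EuclideanSpace ℝ (Fin N) →L[ℝ] ℝ}
    {v : EuclideanSpace ℝ (Fin N)}
    (hw : ∀ x ∈ tsupport g, HasFDerivAt w (w' x) x)
    (h0 : Integrable fun x => w x * inner ℝ (f x) (g x))
    (h1 : Integrable fun x => w x * inner ℝ (f x) ((∂_{v} g) x))
    (h2 : Integrable fun x => w x * inner ℝ ((∂_{v} f) x) (g x))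
    (h3 : Integrable fun x => w' x v * inner ℝ (f x) (g x)) :
    ∫ x, w x * inner ℝ (f x) ((∂_{v} g) x) =
      -(∫ x, w x * inner ℝ ((∂_{v} f) x) (g x)) - ∫ x, w' x v * inner ℝ (f x) (g x) := by
  have key := integral_bilinear_hasFDerivAt_right_eq_neg_left_of_integrable (μ := volume)
    (f := fun x => w x • f x) (f' := fun x => w x • fderiv ℝ f x + (w' x).smulRight (f x))
    (g := g) (g' := fun x => fderiv ℝ g x) (v := v) (B := realInner) ?_ ?_ ?_ ?_ ?_
  · simp only [realInner_apply, add_apply,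
      smul_apply, ContinuousLinearMap.smulRight_apply, inner_add_left,
      real_inner_smul_left] at key
    simp only [SchwartzMap.lineDerivOp_apply_eq_fderiv] at h1 h2 h3 ⊢
    rw [key, integral_add h2 h3]
    ring
  · simp only [realInner_apply, add_apply,
      smul_apply, ContinuousLinearMap.smulRight_apply, inner_add_left,
      real_inner_smul_left]
    simp only [SchwartzMap.lineDerivOp_apply_eq_fderiv] at h1 h2 h3 ⊢
    exact h2.add h3
  · simpa only [realInner_apply, real_inner_smul_left,
      SchwartzMap.lineDerivOp_apply_eq_fderiv] using h1
  · simpa only [realInner_apply, real_inner_smul_left] using h0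
  · intro x hx
    exact (hw x hx).smul (f.hasFDerivAt x)
  · intro x _
    exact g.hasFDerivAt x

/-- The regularisation `(δ + |x|²)^{-q}` of the Hardy weight `|x|^{-2q}`. -/
def hardyWeight (δ : ℝ) (q : ℕ) (x : EuclideanSpace ℝ (Fin N)) : ℝ := ((δ + ‖x‖ ^ 2) ^ q)⁻¹

theorem hardyWeight_nonneg {δ : ℝ} (hδ : 0 < δ) (q : ℕ) (x : EuclideanSpace ℝ (Fin N)) :
    0 ≤ hardyWeight δ q x := by unfold hardyWeight; positivity

theorem continuous_hardyWeight {δ : ℝ} (hδ : 0 < δ) (q : ℕ) :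
    Continuous (hardyWeight δ q : EuclideanSpace ℝ (Fin N) → ℝ) := by
  unfold hardyWeight
  exact Continuous.inv₀ (by fun_prop) fun x => by positivity

theorem hardyWeight_le {δ : ℝ} (hδ : 0 < δ) (q : ℕ) (x : EuclideanSpace ℝ (Fin N)) :
    hardyWeight δ q x ≤ (δ ^ q)⁻¹ := by
  unfold hardyWeight
  gcongr
  nlinarith [sq_nonneg ‖x‖]

theorem integrable_hardyWeight {δ : ℝ} (hδ : 0 < δ) (q : ℕ)
    (f g : 𝓢(EuclideanSpace ℝ (Fin N), ℂ)) :
    Integrable fun x => hardyWeight δ q x * inner ℝ (f x) (g x) := by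
  apply integrable_mul_inner_of_growth (continuous_hardyWeight hδ q) (C := (δ ^ q)⁻¹) (k := 0)
  intro x
  rw [abs_of_nonneg (hardyWeight_nonneg hδ q x)]
  simpa using hardyWeight_le hδ q x

/-- One step of Hardy's inequality: integrate the divergence of the field `x (δ + |x|²)^{-q-1}`
against `|v|²` and absorb the cross term. -/
theorem hardy_step {δ : ℝ} (hδ : 0 < δ) {q : ℕ} (hq : 2 * q + 3 ≤ N)
    (v : 𝓢(EuclideanSpace ℝ (Fin N), ℂ)) :
    ∫ x, hardyWeight δ (q + 1) x * ‖v x‖ ^ 2 ≤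
      4 * N * ∑ i, ∫ x, hardyWeight δ q x *
        ‖coordDeriv i v x‖ ^ 2 := by
  have hNpos : (0 : ℝ) < N := by exact_mod_cast (by omega : 0 < N)
  have hqN : (2 * q + 3 : ℝ) ≤ N := by exact_mod_cast hq
  -- the vector field `x ↦ x ω(x)`, whose divergence is at least `ω`
  let w : Fin N → EuclideanSpace ℝ (Fin N) → ℝ := fun i x => x i * hardyWeight δ (q + 1) x
  let w' : Fin N → EuclideanSpace ℝ (Fin N) → EuclideanSpace ℝ (Fin N) →L[ℝ] ℝ := fun i x =>
    x i • (-((q + 1 : ℕ) * (δ + ‖x‖ ^ 2) ^ q / ((δ + ‖x‖ ^ 2) ^ (q + 1)) ^ 2) •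
      (2 • innerSL ℝ x)) + hardyWeight δ (q + 1) x • EuclideanSpace.proj i
  have hw : ∀ i x, HasFDerivAt (w i) (w' i x) x := by
    intro i x
    have h1 : HasFDerivAt (fun x : EuclideanSpace ℝ (Fin N) => x i)
      (EuclideanSpace.proj (𝕜 := ℝ) i) x := (EuclideanSpace.proj (𝕜 := ℝ) i).hasFDerivAt
    have h2 : HasFDerivAt (fun x : EuclideanSpace ℝ (Fin N) => δ + ‖x‖ ^ 2) (2 • innerSL ℝ x) x :=
      (hasStrictFDerivAt_norm_sq x).hasFDerivAt.const_add δ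
    have h3 : HasDerivAt (fun t : ℝ => (t ^ (q + 1))⁻¹)
        (-((q + 1 : ℕ) * (δ + ‖x‖ ^ 2) ^ q / ((δ + ‖x‖ ^ 2) ^ (q + 1)) ^ 2)) (δ + ‖x‖ ^ 2) := by
      have := (hasDerivAt_pow (q + 1) (δ + ‖x‖ ^ 2)).inv (by positivity)
      rw [neg_div] at this
      exact this
    exact h1.mul (HasDerivAt.comp_hasFDerivAt (f := fun x => δ + ‖x‖ ^ 2) x h3 h2)
  have hw'e : ∀ i x, w' i x (EuclideanSpace.single i 1) = hardyWeight δ (q + 1) x -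
      2 * (q + 1) * (x i) ^ 2 * hardyWeight δ (q + 2) x := by
    intro i x
    have : 0 < δ + ‖x‖ ^ 2 := by positivity
    simp [w', hardyWeight, EuclideanSpace.inner_single_right]
    field_simp
    ring
  have hdiv_weight : ∀ x : EuclideanSpace ℝ (Fin N), (δ + ‖x‖ ^ 2) * hardyWeight δ (q + 2) x = hardyWeight δ (q + 1) x := by
    intro x
    have : 0 < δ + ‖x‖ ^ 2 := by positivity
    simp only [hardyWeight]
    field_simp
    ring
  have hdiv_weight' : ∀ x : EuclideanSpace ℝ (Fin N), (δ + ‖x‖ ^ 2) * hardyWeight δ (q + 1) x = hardyWeight δ q x := by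
    intro x
    have : 0 < δ + ‖x‖ ^ 2 := by positivity
    simp only [hardyWeight]
    field_simp
    ring
  have hxi : ∀ (x : EuclideanSpace ℝ (Fin N)) i, |x i| ≤ ‖x‖ := fun x i => by
    simpa using PiLp.norm_apply_le x i
  have hcw : ∀ i, Continuous (w i) := fun i => by
    have := continuous_hardyWeight (N := N) hδ (q + 1)
    fun_prop
  have hcw' : ∀ i, Continuous fun x => w' i x (EuclideanSpace.single i 1) := fun i => by
    simp only [hw'e]
    have := continuous_hardyWeight (N := N) hδ (q + 1)
    have := continuous_hardyWeight (N := N) hδ (q + 2)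
    fun_prop
  have hbw : ∀ i x, |w i x| ≤ (δ ^ (q + 1))⁻¹ * ‖x‖ ^ 1 := fun i x => by
    rw [abs_mul, abs_of_nonneg (hardyWeight_nonneg hδ _ x), pow_one, mul_comm]
    gcongr
    · exact hardyWeight_le hδ _ x
    · exact hxi x i
  have hsq : ∀ (x : EuclideanSpace ℝ (Fin N)) i, x i ^ 2 ≤ ‖x‖ ^ 2 := fun x i =>
    sq_le_sq' (by linarith [neg_abs_le (x i), hxi x i]) ((le_abs_self _).trans (hxi x i))
  have hbw' : ∀ i x, |w' i x (EuclideanSpace.single i 1)| ≤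
      ((1 + 2 * (q + 1)) * (δ ^ (q + 1))⁻¹) * ‖x‖ ^ 0 := fun i x => by
    rw [hw'e, pow_zero, mul_one]
    have h1 := hardyWeight_nonneg hδ (q + 1) x
    have h2 := hardyWeight_nonneg hδ (q + 2) x
    have h3 := hardyWeight_le hδ (q + 1) x
    have h4 : 0 ≤ (x i) ^ 2 * hardyWeight δ (q + 2) x := by positivity
    have h5 : (x i) ^ 2 * hardyWeight δ (q + 2) x ≤ hardyWeight δ (q + 1) x := by
      rw [← hdiv_weight x]
      gcongr
      linarith [hsq x i]
    have hq0 : (0 : ℝ) ≤ q := by positivity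
    calc |hardyWeight δ (q + 1) x - 2 * (q + 1) * (x i) ^ 2 * hardyWeight δ (q + 2) x|
        ≤ |hardyWeight δ (q + 1) x| + |2 * (q + 1) * (x i) ^ 2 * hardyWeight δ (q + 2) x| :=
          abs_sub _ _
      _ = hardyWeight δ (q + 1) x + 2 * (q + 1) * ((x i) ^ 2 * hardyWeight δ (q + 2) x) := by
          rw [abs_of_nonneg h1, abs_of_nonneg (by positivity)]; ring
      _ ≤ (1 + 2 * (q + 1)) * hardyWeight δ (q + 1) x := by nlinarith
      _ ≤ _ := by gcongr
  have hibp : ∀ i, ∫ x, w' i x (EuclideanSpace.single i 1) * inner ℝ (v x) (v x) =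
      ∫ x, -2 * (w i x * inner ℝ (v x) (coordDeriv i v x)) := by
    intro i
    have h := integral_mul_inner_lineDeriv (f := v) (g := v) (v := EuclideanSpace.single i 1)
      (fun x _ => hw i x) (integrable_mul_inner_of_growth (hcw i) (hbw i))
      (integrable_mul_inner_of_growth (hcw i) (hbw i))
      (integrable_mul_inner_of_growth (hcw i) (hbw i))
      (integrable_mul_inner_of_growth (hcw' i) (hbw' i))
    simp_rw [real_inner_comm (v _) ((∂_{EuclideanSpace.single i (1 : ℝ)} v :
      𝓢(EuclideanSpace ℝ (Fin N), ℂ)) _)] at h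
    rw [integral_const_mul]
    linarith
  have hI1 : ∀ k, ∀ f : 𝓢(EuclideanSpace ℝ (Fin N), ℂ),
      Integrable fun x => hardyWeight δ k x * ‖f x‖ ^ 2 := fun k f => by
    simpa only [real_inner_self_eq_norm_sq] using integrable_hardyWeight hδ k f f
  -- the cross terms are absorbed by Young's inequality
  have hyoung : ∀ i, ∫ x, -2 * (w i x * inner ℝ (v x) (coordDeriv i v x)) ≤
      1 / (2 * N) * (∫ x, hardyWeight δ (q + 1) x * ‖v x‖ ^ 2) +
      2 * N * ∫ x, hardyWeight δ q x * ‖coordDeriv i v x‖ ^ 2 := by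
    intro i
    rw [← integral_const_mul, ← integral_const_mul,
      ← integral_add ((hI1 _ _).const_mul _) ((hI1 _ _).const_mul _)]
    refine integral_mono ((integrable_mul_inner_of_growth (hcw i) (hbw i)).const_mul _)
      (((hI1 _ _).const_mul _).add ((hI1 _ _).const_mul _)) fun x => ?_
    have h1 := hardyWeight_nonneg hδ (q + 1) x
    have h2 : |inner ℝ (v x) (coordDeriv i v x)| ≤ ‖v x‖ * ‖coordDeriv i v x‖ :=
      abs_real_inner_le_norm _ _
    set a := ‖v x‖
    set b := ‖coordDeriv i v x‖
    set κ := hardyWeight δ (q + 1) x with hκ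
    have h3 : κ * ‖x‖ ^ 2 ≤ hardyWeight δ q x := by
      rw [← hdiv_weight' x]; nlinarith
    have h4 : -2 * (w i x * inner ℝ (v x) (coordDeriv i v x)) ≤ 2 * (‖x‖ * κ * (a * b)) := by
      have : |w i x * inner ℝ (v x) (coordDeriv i v x)| ≤ ‖x‖ * κ * (a * b) := by
        rw [abs_mul]
        gcongr
        change |x i * κ| ≤ _
        rw [abs_mul, abs_of_nonneg h1]
        gcongr
        exact hxi x i
      linarith [neg_abs_le (w i x * inner ℝ (v x) (coordDeriv i v x))]
    have h5 : 2 * (‖x‖ * (a * b)) ≤ 1 / (2 * N) * a ^ 2 + 2 * N * (‖x‖ ^ 2 * b ^ 2) := by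
      have h6 := sq_nonneg (a - 2 * N * (‖x‖ * b))
      rw [div_mul_eq_mul_div, one_mul, ← sub_nonneg]
      have : a ^ 2 / (2 * N) + 2 * N * (‖x‖ ^ 2 * b ^ 2) - 2 * (‖x‖ * (a * b)) =
          (a - 2 * N * (‖x‖ * b)) ^ 2 / (2 * N) := by field_simp; ring
      rw [this]; positivity
    calc _ ≤ κ * (2 * (‖x‖ * (a * b))) := h4.trans (le_of_eq (by ring))
      _ ≤ κ * (1 / (2 * N) * a ^ 2 + 2 * N * (‖x‖ ^ 2 * b ^ 2)) := by gcongr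
      _ = 1 / (2 * N) * (κ * a ^ 2) + 2 * N * ((κ * ‖x‖ ^ 2) * b ^ 2) := by ring
      _ ≤ _ := by gcongr
  have hdiv : ∫ x, hardyWeight δ (q + 1) x * ‖v x‖ ^ 2 ≤
      ∑ i, ∫ x, w' i x (EuclideanSpace.single i 1) * inner ℝ (v x) (v x) := by
    rw [← integral_finsetSum _ fun i _ =>
      integrable_mul_inner_of_growth (hcw' i) (hbw' i)]
    refine integral_mono (hI1 _ _) (integrable_finsetSum _ fun i _ =>
      integrable_mul_inner_of_growth (hcw' i) (hbw' i)) fun x => ?_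
    simp only []
    rw [← Finset.sum_mul, real_inner_self_eq_norm_sq]
    gcongr
    simp only [hw'e, Finset.sum_sub_distrib, Finset.sum_const, Finset.card_univ, Fintype.card_fin,
      nsmul_eq_mul, ← Finset.sum_mul, ← Finset.mul_sum]
    rw [← EuclideanSpace.real_norm_sq_eq x]
    have h1 := hardyWeight_nonneg hδ (q + 1) x
    have h2 := hardyWeight_nonneg hδ (q + 2) x
    have h3 : ‖x‖ ^ 2 * hardyWeight δ (q + 2) x ≤ hardyWeight δ (q + 1) x := by
      rw [← hdiv_weight x]; nlinarith
    have hq0 : (0 : ℝ) ≤ q := by positivity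
    nlinarith
  have hsum : ∑ i, ∫ x, w' i x (EuclideanSpace.single i 1) * inner ℝ (v x) (v x) ≤
      1 / 2 * (∫ x, hardyWeight δ (q + 1) x * ‖v x‖ ^ 2) +
      2 * N * ∑ i, ∫ x, hardyWeight δ q x * ‖coordDeriv i v x‖ ^ 2 := by
    calc _ ≤ ∑ i : Fin N, (1 / (2 * N) * (∫ x, hardyWeight δ (q + 1) x * ‖v x‖ ^ 2) +
        2 * N * ∫ x, hardyWeight δ q x * ‖coordDeriv i v x‖ ^ 2) :=
          Finset.sum_le_sum fun i _ => (hibp i).trans_le (hyoung i)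
      _ = _ := by
        rw [Finset.sum_add_distrib, ← Finset.mul_sum, Finset.sum_const, Finset.card_univ,
          Fintype.card_fin, nsmul_eq_mul, ← Finset.mul_sum]
        field_simp
  linarith

theorem hardy_iterate {δ : ℝ} (hδ : 0 < δ) {q : ℕ} (hq : 2 * q + 1 ≤ N)
    (v : 𝓢(EuclideanSpace ℝ (Fin N), ℂ)) {A : ℝ}
    (hA : ∀ m : List (Fin N), m.length = q → ∫ x, ‖schPartial m v x‖ ^ 2 ≤ A) :
    ∫ x, hardyWeight δ q x * ‖v x‖ ^ 2 ≤ (4 * (N : ℝ) ^ 2) ^ q * A := by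
  induction q generalizing v with
  | zero => simpa [hardyWeight] using hA [] rfl
  | succ q ih =>
    refine (hardy_step hδ (by omega) v).trans ?_
    have : ∀ i, ∫ x, hardyWeight δ q x * ‖coordDeriv i v x‖ ^ 2 ≤ (4 * (N : ℝ) ^ 2) ^ q * A := by
      intro i
      refine ih (by omega) (coordDeriv i v) fun m hm => ?_
      have := hA (m ++ [i]) (by simp [hm])
      simpa [schPartial, List.foldr_append] using this
    calc _ ≤ 4 * (N : ℝ) * ∑ _i : Fin N, (4 * (N : ℝ) ^ 2) ^ q * A := by gcongr; exact this _
      _ = _ := by simp; ring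

/-! ### Hardy's inequality in `H⁴` -/

theorem eLpNorm_two_eq_sqrt_integral {F : Type*} [NormedAddCommGroup F]
    {f : EuclideanSpace ℝ (Fin N) → F} (hf : MemLp f 2 volume) :
    eLpNorm f 2 volume = ENNReal.ofReal (Real.sqrt (∫ x, ‖f x‖ ^ 2)) := by
  rw [hf.eLpNorm_eq_integral_rpow_norm (by simp) (by simp), Real.sqrt_eq_rpow]
  simp

theorem ae_ne_zero (hN : 0 < N) : ∀ᵐ x : EuclideanSpace ℝ (Fin N), x ≠ 0 := by
  have : Nonempty (Fin N) := ⟨⟨0, hN⟩⟩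
  have : Nontrivial (EuclideanSpace ℝ (Fin N)) := inferInstance
  exact Measure.ae_ne volume 0

/-- The norm `‖|x|^s D_l u‖₂`, with values in `[0, ∞]`. -/
def weightedNorm (s : ℝ) (l : List (Fin N)) (u : LTwo N) : ℝ≥0∞ :=
  eLpNorm (fun x => ‖x‖ ^ s • weakPartial l u x) 2 volume

/-- The regularised Hardy inequality for Schwartz functions passes to `H⁴`. -/
theorem eLpNorm_hardyWeight_smul_le (hN : 8 < N) {u : LTwo N} (hu : MemSobolev 4 2 u.toDistr)
    {l : List (Fin N)} {q : ℕ} (hl : l.length + q = 4) {K : ℝ} (hK0 : 0 ≤ K)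
    (hK : ∀ m : List (Fin N), m.length = 4 → ‖weakPartial m u‖ ≤ K) {δ : ℝ} (hδ : 0 < δ) :
    eLpNorm (fun x => Real.sqrt (hardyWeight δ q x) • weakPartial l u x) 2 volume ≤
      ENNReal.ofReal ((2 * N) ^ q * K) := by
  set M : ℝ := Real.sqrt ((δ ^ q)⁻¹)
  have hM : ∀ x : EuclideanSpace ℝ (Fin N), Real.sqrt (hardyWeight δ q x) ≤ M := fun x =>
    Real.sqrt_le_sqrt (hardyWeight_le hδ q x)
  have hθ : Continuous fun x : EuclideanSpace ℝ (Fin N) => Real.sqrt (hardyWeight δ q x) :=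
    (continuous_hardyWeight hδ q).sqrt
  have main : ∀ ε : ℝ, 0 < ε →
      eLpNorm (fun x => Real.sqrt (hardyWeight δ q x) • weakPartial l u x) 2 volume ≤
      ENNReal.ofReal (M * ε + (2 * N) ^ q * (K + ε)) := by
    intro ε hε
    obtain ⟨ψ, hψ⟩ := exists_schwartz_weakPartial_sub_lt hu hε
    have hsub : ∀ m : List (Fin N), m.length ≤ 4 →
        weakPartial m (u - ψ.toLp 2 volume) = weakPartial m u - (schPartial m ψ).toLp 2 volume :=
      fun m hm => by rw [weakPartial_sub hm hu (memSobolev_toLp ψ 4), weakPartial_toLp]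
    have hmem : MemLp (fun x => Real.sqrt (hardyWeight δ q x) • schPartial l ψ x) 2 volume := by
      refine ((schPartial l ψ).memLp 2 volume).of_le_mul (c := M)
        (by fun_prop) (.of_forall fun x => ?_)
      rw [norm_smul, Real.norm_eq_abs, abs_of_nonneg (Real.sqrt_nonneg _)]
      gcongr
      exact hM x
    have h1 : eLpNorm (fun x => Real.sqrt (hardyWeight δ q x) • schPartial l ψ x) 2 volume ≤
        ENNReal.ofReal ((2 * N) ^ q * (K + ε)) := by
      rw [eLpNorm_two_eq_sqrt_integral hmem]
      apply ENNReal.ofReal_le_ofReal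
      apply Real.sqrt_le_iff.2 ⟨by positivity, ?_⟩
      have h := hardy_iterate hδ (q := q) (by omega) (schPartial l ψ) (A := (K + ε) ^ 2) ?_
      · calc _ = ∫ x, hardyWeight δ q x * ‖schPartial l ψ x‖ ^ 2 := by
              congr with x
              rw [norm_smul, mul_pow, Real.norm_eq_abs, sq_abs,
                Real.sq_sqrt (hardyWeight_nonneg hδ q x)]
          _ ≤ _ := h
          _ = _ := by rw [mul_pow ((2 * (N : ℝ)) ^ q), ← pow_mul, mul_comm q 2, pow_mul]; ring
      · intro m hm
        have hml : (m ++ l).length = 4 := by simp; omega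
        have e : schPartial m (schPartial l ψ) = schPartial (m ++ l) ψ := by
          simp [schPartial, List.foldr_append]
        rw [e]
        have h2 : ‖(schPartial (m ++ l) ψ).toLp 2 volume‖ ≤ K + ε := by
          have h3 := hψ (m ++ l) hml.le
          have h4 := hK (m ++ l) hml
          rw [hsub _ hml.le] at h3
          rw [norm_sub_rev] at h3
          linarith [norm_le_norm_add_norm_sub' ((schPartial (m ++ l) ψ).toLp 2 volume)
            (weakPartial (m ++ l) u)]
        rw [SchwartzMap.norm_toLp, eLpNorm_two_eq_sqrt_integral
          ((schPartial (m ++ l) ψ).memLp 2 volume), ENNReal.toReal_ofReal (Real.sqrt_nonneg _)] at h2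
        exact (Real.sqrt_le_left (by positivity)).1 h2
    have h2 : eLpNorm (fun x => Real.sqrt (hardyWeight δ q x) •
        weakPartial l (u - ψ.toLp 2 volume) x) 2 volume ≤ ENNReal.ofReal (M * ε) := by
      refine (eLpNorm_le_mul_eLpNorm_of_ae_le_mul
        (g := weakPartial l (u - ψ.toLp 2 volume)) (c := M) (.of_forall fun x => ?_) 2).trans ?_
      · rw [norm_smul, Real.norm_eq_abs, abs_of_nonneg (Real.sqrt_nonneg _)]
        gcongr
        exact hM x
      · rw [← Lp.enorm_def, ← ofReal_norm, ← ENNReal.ofReal_mul (Real.sqrt_nonneg _)]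
        apply ENNReal.ofReal_le_ofReal
        gcongr
        exact (hψ l (by omega)).le
    have hae : (fun x => Real.sqrt (hardyWeight δ q x) • weakPartial l u x) =ᵐ[volume]
        (fun x => Real.sqrt (hardyWeight δ q x) • weakPartial l (u - ψ.toLp 2 volume) x) +
        fun x => Real.sqrt (hardyWeight δ q x) • schPartial l ψ x := by
      rw [hsub l (by omega)]
      filter_upwards [Lp.coeFn_sub (weakPartial l u) ((schPartial l ψ).toLp 2 volume),
        (schPartial l ψ).coeFn_toLp 2 volume] with x hx1 hx2
      simp only [Pi.add_apply, hx1, Pi.sub_apply, hx2, smul_sub, sub_add_cancel]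
    rw [eLpNorm_congr_ae hae]
    refine (eLpNorm_add_le (hθ.aestronglyMeasurable.smul (Lp.aestronglyMeasurable _))
      (by fun_prop) (by norm_num)).trans ?_
    rw [ENNReal.ofReal_add (by positivity) (by positivity)]
    exact add_le_add h2 h1
  have ht : Filter.Tendsto (fun ε : ℝ => ENNReal.ofReal (M * ε + (2 * N) ^ q * (K + ε)))
      (nhdsWithin 0 (Set.Ioi 0)) (nhds (ENNReal.ofReal ((2 * N) ^ q * K))) := by
    have hc : Continuous fun ε : ℝ => ENNReal.ofReal (M * ε + (2 * N) ^ q * (K + ε)) :=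
      ENNReal.continuous_ofReal.comp (by fun_prop)
    have := hc.tendsto 0
    simp only [mul_zero, zero_add, add_zero] at this
    exact this.mono_left nhdsWithin_le_nhds
  refine ge_of_tendsto ht ?_
  filter_upwards [self_mem_nhdsWithin] with ε hε using main ε hε

/-- **Hardy's inequality** in `H⁴(ℝ^N)`, `N > 8`: the functions `|x|^{-h} D^{4-h} u` are controlled
by the fourth order derivatives. -/
theorem weightedNorm_le_of_norm_le (hN : 8 < N) {u : LTwo N} (hu : MemSobolev 4 2 u.toDistr)
    {l : List (Fin N)} (hl : l.length ≤ 4) {K : ℝ} (hK0 : 0 ≤ K)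
    (hK : ∀ m : List (Fin N), m.length = 4 → ‖weakPartial m u‖ ≤ K) :
    weightedNorm ((l.length : ℝ) - 4) l u ≤ ENNReal.ofReal ((2 * N) ^ 4 * K) := by
  obtain ⟨q, hq⟩ := Nat.exists_eq_add_of_le hl
  have hN1 : (1 : ℝ) ≤ 2 * N := by
    have : (8 : ℝ) < N := by exact_mod_cast hN
    linarith
  have hqr : (l.length : ℝ) - 4 = -q := by
    have : (4 : ℝ) = l.length + q := by exact_mod_cast hq
    linarith
  have hb : ∀ n : ℕ, eLpNorm (fun x => Real.sqrt (hardyWeight (1 / ((n : ℝ) + 1)) q x) •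
      weakPartial l u x) 2 volume ≤ ENNReal.ofReal ((2 * N) ^ 4 * K) := fun n => by
    refine (eLpNorm_hardyWeight_smul_le hN hu hq.symm hK0 hK (by positivity)).trans ?_
    apply ENNReal.ofReal_le_ofReal
    gcongr
    omega
  refine (Lp.eLpNorm_lim_le_liminf_eLpNorm (f := fun n x =>
      Real.sqrt (hardyWeight (1 / ((n : ℝ) + 1)) q x) • weakPartial l u x) (fun n => ?_) _ ?_).trans
      (Filter.liminf_le_of_frequently_le' (Filter.Frequently.of_forall hb))
  · exact ((continuous_hardyWeight (by positivity) q).sqrt.aestronglyMeasurable).smul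
      (Lp.aestronglyMeasurable _)
  · filter_upwards [ae_ne_zero (N := N) (by omega)] with x hx
    have hx' : 0 < ‖x‖ := norm_pos_iff.2 hx
    apply Filter.Tendsto.smul_const
    have h1 : ‖x‖ ^ ((l.length : ℝ) - 4) = Real.sqrt (hardyWeight 0 q x) := by
      rw [hqr, hardyWeight, zero_add, Real.rpow_neg hx'.le, Real.rpow_natCast, Real.sqrt_inv,
        ← pow_mul, mul_comm 2 q, pow_mul, Real.sqrt_sq (by positivity)]
    rw [h1]
    have hc : ContinuousAt (fun δ : ℝ => Real.sqrt (hardyWeight δ q x)) 0 := by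
      unfold hardyWeight
      refine ContinuousAt.sqrt (ContinuousAt.inv₀ (by fun_prop) ?_)
      positivity
    exact hc.tendsto.comp tendsto_one_div_add_atTop_nhds_zero_nat

/-! ### Test functions and weighted integration by parts -/

/-- Smooth functions with compact support in `ℝ^N ∖ {0}`, as a subclass of the Schwartz space. -/
structure IsTest (f : 𝓢(EuclideanSpace ℝ (Fin N), ℂ)) : Prop where
  hasCompactSupport : HasCompactSupport f
  zero_notMem : (0 : EuclideanSpace ℝ (Fin N)) ∉ tsupport f

namespace IsTest

variable {f g : 𝓢(EuclideanSpace ℝ (Fin N), ℂ)}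

theorem coordDeriv (hf : IsTest f) (i : Fin N) : IsTest (coordDeriv i f) := by
  have h := SchwartzMap.tsupport_lineDerivOp_subset (EuclideanSpace.single i (1 : ℝ)) f
  exact ⟨hf.1.of_isClosed_subset (isClosed_tsupport _) h, fun h0 => hf.2 (h h0)⟩

theorem schPartial (hf : IsTest f) (l : List (Fin N)) : IsTest (schPartial l f) := by
  induction l with
  | nil => exact hf
  | cons i l ih => exact ih.coordDeriv i

theorem zero : IsTest (0 : 𝓢(EuclideanSpace ℝ (Fin N), ℂ)) := by
  have : ⇑(0 : 𝓢(EuclideanSpace ℝ (Fin N), ℂ)) = 0 := rfl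
  exact ⟨by rw [this]; exact HasCompactSupport.zero, by rw [this]; simp⟩

theorem add (hf : IsTest f) (hg : IsTest g) : IsTest (f + g) := by
  refine ⟨hf.1.add hg.1, fun h => ?_⟩
  rcases tsupport_add f g h with h | h
  exacts [hf.2 h, hg.2 h]

theorem sum {ι : Type*} {s : Finset ι} {F : ι → 𝓢(EuclideanSpace ℝ (Fin N), ℂ)}
    (hF : ∀ i, IsTest (F i)) : IsTest (∑ i ∈ s, F i) := by
  classical
  induction s using Finset.induction_on with
  | empty => simpa using zero
  | insert i s hi ih => rw [Finset.sum_insert hi]; exact (hF i).add ih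

theorem apply_zero (hf : IsTest f) : f 0 = 0 := image_eq_zero_of_notMem_tsupport hf.2

end IsTest

theorem laplacian_eq_sum_coordDeriv (f : 𝓢(EuclideanSpace ℝ (Fin N), ℂ)) :
    Δ f = ∑ i, coordDeriv i (coordDeriv i f) := by
  simpa using SchwartzMap.laplacian_eq_sum (EuclideanSpace.basisFun (Fin N) ℝ) f

theorem IsTest.laplacian {f : 𝓢(EuclideanSpace ℝ (Fin N), ℂ)} (hf : IsTest f) :
    IsTest (Δ f) := by
  rw [laplacian_eq_sum_coordDeriv]
  exact IsTest.sum fun i => (hf.coordDeriv i).coordDeriv i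

theorem coordDeriv_comm (i j : Fin N) (f : 𝓢(EuclideanSpace ℝ (Fin N), ℂ)) :
    coordDeriv i (coordDeriv j f) = coordDeriv j (coordDeriv i f) := by
  have key : ∀ a b : Fin N, ∀ x, coordDeriv a (coordDeriv b f) x =
      fderiv ℝ (fderiv ℝ f) x (EuclideanSpace.single a 1) (EuclideanSpace.single b 1) := by
    intro a b x
    have h1 : ⇑(coordDeriv b f) = fun y => fderiv ℝ f y (EuclideanSpace.single b 1) :=
      funext fun y => SchwartzMap.lineDerivOp_apply_eq_fderiv _ f y
    have hd : DifferentiableAt ℝ (fderiv ℝ f) x :=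
      ((f.smooth 2).fderiv_right (m := 1) (by norm_num)).differentiable (by norm_num) x
    rw [SchwartzMap.lineDerivOp_apply_eq_fderiv, h1, fderiv_clm_apply hd (by fun_prop)]
    simp
  ext x
  rw [key, key]
  exact ((f.smooth 2).contDiffAt.isSymmSndFDerivAt (by simp)).eq _ _

theorem coordDeriv_sum {ι : Type*} (i : Fin N) (s : Finset ι)
    (F : ι → 𝓢(EuclideanSpace ℝ (Fin N), ℂ)) :
    coordDeriv i (∑ j ∈ s, F j) = ∑ j ∈ s, coordDeriv i (F j) :=
  LineDeriv.lineDerivOp_sum _ _ _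

theorem coordDeriv_laplacian (i : Fin N) (f : 𝓢(EuclideanSpace ℝ (Fin N), ℂ)) :
    coordDeriv i (Δ f) = Δ (coordDeriv i f) := by
  simp only [laplacian_eq_sum_coordDeriv, coordDeriv_sum]
  refine Finset.sum_congr rfl fun j _ => ?_
  rw [coordDeriv_comm, coordDeriv_comm i j f]

/-- The weighted real inner product `∫ w ⟪f, g⟫`. -/
def weightedInner (w : EuclideanSpace ℝ (Fin N) → ℝ) (f g : 𝓢(EuclideanSpace ℝ (Fin N), ℂ)) : ℝ :=
  ∫ x, w x * inner ℝ (f x) (g x)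

/-- The weighted square norm `∫ |x|^p |f|²`. -/
def powerEnergy (p : ℝ) (f : 𝓢(EuclideanSpace ℝ (Fin N), ℂ)) : ℝ :=
  ∫ x, ‖x‖ ^ p * ‖f x‖ ^ 2

theorem powerEnergy_nonneg (p : ℝ) (f : 𝓢(EuclideanSpace ℝ (Fin N), ℂ)) : 0 ≤ powerEnergy p f :=
  integral_nonneg fun _ => by positivity

theorem continuousOn_norm_rpow (p : ℝ) :
    ContinuousOn (fun x : EuclideanSpace ℝ (Fin N) => ‖x‖ ^ p) {0}ᶜ :=
  continuous_norm.continuousOn.rpow_const fun _ hx => Or.inl (norm_ne_zero_iff.2 hx)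

theorem weightedInner_comm (w : EuclideanSpace ℝ (Fin N) → ℝ)
    (f g : 𝓢(EuclideanSpace ℝ (Fin N), ℂ)) : weightedInner w f g = weightedInner w g f := by
  unfold weightedInner
  congr with x
  rw [real_inner_comm]

theorem weightedInner_self (p : ℝ) (f : 𝓢(EuclideanSpace ℝ (Fin N), ℂ)) :
    weightedInner (fun x => ‖x‖ ^ p) f f = powerEnergy p f := by
  simp [weightedInner, powerEnergy]

theorem IsTest.integrable_mul_inner {f g : 𝓢(EuclideanSpace ℝ (Fin N), ℂ)} (hg : IsTest g)
    {w : EuclideanSpace ℝ (Fin N) → ℝ} (hw : ContinuousOn w {0}ᶜ) :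
    Integrable fun x => w x * inner ℝ (f x) (g x) := by
  have hsub : tsupport (fun x => w x * inner ℝ (f x) (g x)) ⊆ tsupport g := by
    refine closure_mono fun x hx => ?_
    contrapose! hx
    simp only [Function.mem_support, not_not] at hx
    simp [hx]
  refine Continuous.integrable_of_hasCompactSupport ?_
    (hg.1.of_isClosed_subset (isClosed_tsupport _) hsub)
  refine ContinuousOn.continuous_of_tsupport_subset (s := {0}ᶜ) ?_ isOpen_compl_singleton
    fun x hx h0 => hg.2 ?_
  · exact hw.mul (Continuous.continuousOn (by fun_prop))
  · rw [Set.mem_singleton_iff.1 h0] at hx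
    exact hsub hx

theorem IsTest.integrable_power {f : 𝓢(EuclideanSpace ℝ (Fin N), ℂ)} (hf : IsTest f) (p : ℝ) :
    Integrable fun x => ‖x‖ ^ p * ‖f x‖ ^ 2 := by
  simpa only [real_inner_self_eq_norm_sq] using
    hf.integrable_mul_inner (f := f) (continuousOn_norm_rpow p)

theorem weightedInner_sum_left {ι : Type*} {s : Finset ι}
    {F : ι → 𝓢(EuclideanSpace ℝ (Fin N), ℂ)} {g : 𝓢(EuclideanSpace ℝ (Fin N), ℂ)}
    (hg : IsTest g) {w : EuclideanSpace ℝ (Fin N) → ℝ} (hw : ContinuousOn w {0}ᶜ) :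
    weightedInner w (∑ i ∈ s, F i) g = ∑ i ∈ s, weightedInner w (F i) g := by
  unfold weightedInner
  rw [← integral_finsetSum _ fun i _ => hg.integrable_mul_inner hw]
  congr with x
  rw [← Finset.mul_sum, ← sum_inner, sum_apply]

/-- Integration by parts against a test function, with a weight that may be singular at the
origin. -/
theorem weightedInner_coordDeriv {f g : 𝓢(EuclideanSpace ℝ (Fin N), ℂ)} (hg : IsTest g)
    {w : EuclideanSpace ℝ (Fin N) → ℝ}
    {w' : EuclideanSpace ℝ (Fin N) → EuclideanSpace ℝ (Fin N) →L[ℝ] ℝ} (i : Fin N)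
    (hw : ∀ x ≠ 0, HasFDerivAt w (w' x) x)
    (hw' : ContinuousOn (fun x => w' x (EuclideanSpace.single i 1)) {0}ᶜ) :
    weightedInner w f (coordDeriv i g) = -weightedInner w (coordDeriv i f) g -
      weightedInner (fun x => w' x (EuclideanSpace.single i 1)) f g := by
  have hc : ContinuousOn w {0}ᶜ := fun x hx => (hw x hx).continuousAt.continuousWithinAt
  refine integral_mul_inner_lineDeriv (w' := w') (fun x hx => hw x ?_) (hg.integrable_mul_inner hc)
    ((hg.coordDeriv i).integrable_mul_inner hc) (hg.integrable_mul_inner hc)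
    (hg.integrable_mul_inner hw')
  rintro rfl
  exact hg.2 hx

theorem hasFDerivAt_norm_rpow_of_ne_zero (p : ℝ) {x : EuclideanSpace ℝ (Fin N)} (hx : x ≠ 0) :
    HasFDerivAt (fun x : EuclideanSpace ℝ (Fin N) => ‖x‖ ^ p)
      ((p * ‖x‖ ^ (p - 2)) • innerSL ℝ x) x := by
  have hx' : 0 < ‖x‖ := norm_pos_iff.2 hx
  have h := (hasStrictFDerivAt_norm_sq x).hasFDerivAt.rpow_const (p := p / 2)
    (Or.inl (by positivity))
  have e : ∀ (y : EuclideanSpace ℝ (Fin N)) (q : ℝ), (‖y‖ ^ 2) ^ (q / 2) = ‖y‖ ^ q := fun y q => by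
    rw [← Real.rpow_natCast, ← Real.rpow_mul (norm_nonneg _)]
    congr 1
    push_cast
    ring
  simp only [e] at h
  convert! h using 1
  have e2 : p / 2 - 1 = (p - 2) / 2 := by ring
  rw [e2, e]
  ext v
  simp
  ring

theorem weightedInner_rpow_coordDeriv {f g : 𝓢(EuclideanSpace ℝ (Fin N), ℂ)} (hg : IsTest g)
    (p : ℝ) (i : Fin N) :
    weightedInner (fun x => ‖x‖ ^ p) f (coordDeriv i g) =
      -weightedInner (fun x => ‖x‖ ^ p) (coordDeriv i f) g -
      weightedInner (fun x => p * ‖x‖ ^ (p - 2) * x i) f g := by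
  have e : ∀ x : EuclideanSpace ℝ (Fin N), ((p * ‖x‖ ^ (p - 2)) • innerSL ℝ x)
      (EuclideanSpace.single i 1) = p * ‖x‖ ^ (p - 2) * x i := fun x => by
    simp [EuclideanSpace.inner_single_right]
  have h := weightedInner_coordDeriv (f := f) hg i
    (fun x hx => hasFDerivAt_norm_rpow_of_ne_zero p hx) ?_
  · simpa only [e] using h
  · simp only [e]
    have := continuousOn_norm_rpow (N := N) (p - 2)
    fun_prop

theorem weightedInner_coord_rpow_coordDeriv {f g : 𝓢(EuclideanSpace ℝ (Fin N), ℂ)}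
    (hg : IsTest g) (c q : ℝ) (i : Fin N) :
    weightedInner (fun x => c * ‖x‖ ^ q * x i) f (coordDeriv i g) =
      -weightedInner (fun x => c * ‖x‖ ^ q * x i) (coordDeriv i f) g -
      weightedInner (fun x => c * (q * ‖x‖ ^ (q - 2) * x i ^ 2 + ‖x‖ ^ q)) f g := by
  have hw : ∀ x : EuclideanSpace ℝ (Fin N), x ≠ 0 →
      HasFDerivAt (fun x : EuclideanSpace ℝ (Fin N) => c * ‖x‖ ^ q * x i)
      ((c * ‖x‖ ^ q) • (EuclideanSpace.proj (𝕜 := ℝ) i) +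
        x i • (c • ((q * ‖x‖ ^ (q - 2)) • innerSL ℝ x))) x := fun x hx =>
    ((hasFDerivAt_norm_rpow_of_ne_zero q hx).const_mul c).mul
      (EuclideanSpace.proj (𝕜 := ℝ) i).hasFDerivAt
  have e : ∀ x : EuclideanSpace ℝ (Fin N), ((c * ‖x‖ ^ q) • (EuclideanSpace.proj (𝕜 := ℝ) i) +
        x i • (c • ((q * ‖x‖ ^ (q - 2)) • innerSL ℝ x))) (EuclideanSpace.single i 1) =
      c * (q * ‖x‖ ^ (q - 2) * x i ^ 2 + ‖x‖ ^ q) := fun x => by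
    simp [EuclideanSpace.inner_single_right]
    ring
  have h := weightedInner_coordDeriv (f := f) hg i hw ?_
  · simpa only [e] using h
  · simp only [e]
    have := continuousOn_norm_rpow (N := N) (q - 2)
    have := continuousOn_norm_rpow (N := N) q
    fun_prop

/-- Young's inequality for weighted inner products. -/
theorem abs_weightedInner_le {f g : 𝓢(EuclideanSpace ℝ (Fin N), ℂ)} (hf : IsTest f)
    (hg : IsTest g) {w : EuclideanSpace ℝ (Fin N) → ℝ} (hwc : ContinuousOn w {0}ᶜ)
    {a b c ε : ℝ} (hc : 0 ≤ c) (hε : 0 < ε) (hw : ∀ x ≠ 0, |w x| ≤ c * ‖x‖ ^ ((a + b) / 2)) :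
    |weightedInner w f g| ≤ ε * powerEnergy a f + c ^ 2 / (4 * ε) * powerEnergy b g := by
  unfold weightedInner powerEnergy
  rw [← integral_const_mul, ← integral_const_mul,
    ← integral_add ((hf.integrable_power a).const_mul _) ((hg.integrable_power b).const_mul _)]
  refine (abs_integral_le_integral_abs).trans (integral_mono (hg.integrable_mul_inner hwc).abs
    (((hf.integrable_power a).const_mul _).add ((hg.integrable_power b).const_mul _)) fun x => ?_)
  simp only []
  rcases eq_or_ne x 0 with rfl | hx
  · simp [hf.apply_zero, hg.apply_zero]
  have hx' : 0 < ‖x‖ := norm_pos_iff.2 hx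
  have h1 : ‖x‖ ^ ((a + b) / 2) = ‖x‖ ^ (a / 2) * ‖x‖ ^ (b / 2) := by
    rw [← Real.rpow_add hx']; ring_nf
  have h2 : ∀ q : ℝ, ‖x‖ ^ q = (‖x‖ ^ (q / 2)) ^ 2 := fun q => by
    rw [← Real.rpow_natCast, ← Real.rpow_mul hx'.le]; congr 1; push_cast; ring
  have h3 := hw x hx
  rw [h1] at h3
  have h4 : |inner ℝ (f x) (g x)| ≤ ‖f x‖ * ‖g x‖ := abs_real_inner_le_norm _ _
  rw [abs_mul, h2 a, h2 b]
  set A := ‖x‖ ^ (a / 2)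
  set B := ‖x‖ ^ (b / 2)
  calc |w x| * |inner ℝ (f x) (g x)| ≤ (c * (A * B)) * (‖f x‖ * ‖g x‖) := by gcongr
    _ ≤ _ := by
      rw [← sub_nonneg]
      have : ε * (A ^ 2 * ‖f x‖ ^ 2) + c ^ 2 / (4 * ε) * (B ^ 2 * ‖g x‖ ^ 2) -
          c * (A * B) * (‖f x‖ * ‖g x‖) =
          (2 * ε * (A * ‖f x‖) - c * (B * ‖g x‖)) ^ 2 / (4 * ε) := by field_simp; ring
      rw [this]
      positivity

/-! ### Weighted estimates of second order -/

theorem abs_coord_le_norm (x : EuclideanSpace ℝ (Fin N)) (i : Fin N) : |x i| ≤ ‖x‖ := by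
  simpa using PiLp.norm_apply_le x i

theorem continuousOn_coord_rpow (c q : ℝ) (i : Fin N) :
    ContinuousOn (fun x : EuclideanSpace ℝ (Fin N) => c * ‖x‖ ^ q * x i) {0}ᶜ := by
  have := continuousOn_norm_rpow (N := N) q
  fun_prop

/-- Young's inequality for the weight `|x|^p`. -/
theorem abs_weightedInner_rpow_le {f g : 𝓢(EuclideanSpace ℝ (Fin N), ℂ)} (hf : IsTest f)
    (hg : IsTest g) {p a b ε : ℝ} (hε : 0 < ε) (hab : a + b = 2 * p) :
    |weightedInner (fun x => ‖x‖ ^ p) f g| ≤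
      ε * powerEnergy a f + 1 / (4 * ε) * powerEnergy b g := by
  have h := abs_weightedInner_le hf hg (continuousOn_norm_rpow p) zero_le_one hε
    (a := a) (b := b) fun x hx => by
      rw [hab, mul_div_cancel_left₀ _ two_ne_zero, one_mul, abs_of_nonneg (by positivity)]
  simpa using h

/-- Young's inequality for the derivative `p |x|^{p-2} xᵢ` of the weight `|x|^p`. -/
theorem abs_weightedInner_coord_rpow_le {f g : 𝓢(EuclideanSpace ℝ (Fin N), ℂ)} (hf : IsTest f)
    (hg : IsTest g) (p : ℝ) {a b ε : ℝ} (hε : 0 < ε) (hab : a + b = 2 * p - 2) (i : Fin N) :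
    |weightedInner (fun x => p * ‖x‖ ^ (p - 2) * x i) f g| ≤
      ε * powerEnergy a f + p ^ 2 / (4 * ε) * powerEnergy b g := by
  have h := abs_weightedInner_le hf hg (continuousOn_coord_rpow p (p - 2) i) (abs_nonneg p) hε
    (a := a) (b := b) fun x hx => by
      have hx' : 0 < ‖x‖ := norm_pos_iff.2 hx
      have e : (a + b) / 2 = (p - 2) + 1 := by linarith
      rw [e, Real.rpow_add hx', Real.rpow_one, abs_mul, abs_mul,
        abs_of_nonneg (by positivity : 0 ≤ ‖x‖ ^ (p - 2)), mul_assoc]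
      gcongr
      exact abs_coord_le_norm x i
  rwa [sq_abs] at h

/-- Interpolation for one partial derivative. -/
theorem powerEnergy_coordDeriv_le {v : 𝓢(EuclideanSpace ℝ (Fin N), ℂ)} (hv : IsTest v)
    (p : ℝ) {ε : ℝ} (hε : 0 < ε) (i : Fin N) :
    powerEnergy p (coordDeriv i v) ≤ ε * powerEnergy (p + 2) (coordDeriv i (coordDeriv i v)) +
      (1 / ε + p ^ 2) * powerEnergy (p - 2) v := by
  have h := weightedInner_rpow_coordDeriv (f := coordDeriv i v) hv p i
  rw [weightedInner_self] at h
  have h1 := abs_weightedInner_rpow_le ((hv.coordDeriv i).coordDeriv i) hv (p := p)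
    (a := p + 2) (b := p - 2) (half_pos hε) (by ring)
  have h2 := abs_weightedInner_coord_rpow_le (hv.coordDeriv i) hv p
    (a := p) (b := p - 2) one_half_pos (by ring) i
  have e : 1 / (4 * (ε / 2)) = 1 / ε / 2 := by field_simp; norm_num
  rw [e] at h1
  norm_num at h2
  linarith [(abs_le.1 h1).1, (abs_le.1 h2).1]

/-- Interpolation for the gradient, in terms of the Laplacian. -/
theorem sum_powerEnergy_coordDeriv_le {v : 𝓢(EuclideanSpace ℝ (Fin N), ℂ)} (hv : IsTest v)
    (p : ℝ) {ε : ℝ} (hε : 0 < ε) :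
    ∑ i, powerEnergy p (coordDeriv i v) ≤ ε * powerEnergy (p + 2) (Δ v) +
      (1 / ε + N * p ^ 2) * powerEnergy (p - 2) v := by
  have h : ∀ i, powerEnergy p (coordDeriv i v) ≤
      2 * -weightedInner (fun x => ‖x‖ ^ p) (coordDeriv i (coordDeriv i v)) v +
      p ^ 2 * powerEnergy (p - 2) v := by
    intro i
    have h := weightedInner_rpow_coordDeriv (f := coordDeriv i v) hv p i
    rw [weightedInner_self] at h
    have h2 := abs_weightedInner_coord_rpow_le (hv.coordDeriv i) hv p
      (a := p) (b := p - 2) one_half_pos (by ring) i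
    norm_num at h2
    linarith [(abs_le.1 h2).1]
  have h1 := abs_weightedInner_rpow_le hv.laplacian hv (p := p)
    (a := p + 2) (b := p - 2) (half_pos hε) (by ring)
  have e : 1 / (4 * (ε / 2)) = 1 / ε / 2 := by field_simp; norm_num
  rw [e] at h1
  have h3 := Finset.sum_le_sum fun i (_ : i ∈ Finset.univ) => h i
  rw [Finset.sum_add_distrib, ← Finset.mul_sum, Finset.sum_neg_distrib,
    ← weightedInner_sum_left hv (continuousOn_norm_rpow p), ← laplacian_eq_sum_coordDeriv,
    Finset.sum_const, Finset.card_univ, Fintype.card_fin, nsmul_eq_mul] at h3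
  linarith [(abs_le.1 h1).1]

/-- The second derivatives are controlled by the Laplacian and, unless `p = 0`, the gradient. -/
theorem sum_powerEnergy_coordDeriv_coordDeriv_le {v : 𝓢(EuclideanSpace ℝ (Fin N), ℂ)}
    (hv : IsTest v) (p : ℝ) :
    ∑ i, ∑ j, powerEnergy p (coordDeriv i (coordDeriv j v)) ≤
      2 * (1 + N) * powerEnergy p (Δ v) +
        (1 + N) * p ^ 2 * ∑ j, powerEnergy (p - 2) (coordDeriv j v) := by
  have hij : ∀ i j, powerEnergy p (coordDeriv i (coordDeriv j v)) ≤
      2 * weightedInner (fun x => ‖x‖ ^ p) (coordDeriv i (coordDeriv i v))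
        (coordDeriv j (coordDeriv j v)) +
      2 * weightedInner (fun x => p * ‖x‖ ^ (p - 2) * x j) (coordDeriv i (coordDeriv i v))
        (coordDeriv j v) + p ^ 2 * powerEnergy (p - 2) (coordDeriv j v) := by
    intro i j
    -- integrating by parts twice turns `|Dᵢⱼ v|²` into `⟪Dᵢᵢ v, Dⱼⱼ v⟫`
    have h1 := weightedInner_rpow_coordDeriv (f := coordDeriv i (coordDeriv j v))
      (hv.coordDeriv j) p i
    rw [weightedInner_self] at h1
    have h2 := weightedInner_rpow_coordDeriv (f := coordDeriv i (coordDeriv i v))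
      (hv.coordDeriv j) p j
    have e : coordDeriv i (coordDeriv i (coordDeriv j v)) =
        coordDeriv j (coordDeriv i (coordDeriv i v)) := by
      rw [coordDeriv_comm i j v, coordDeriv_comm i j]
    rw [e] at h1
    have h3 := abs_weightedInner_coord_rpow_le ((hv.coordDeriv j).coordDeriv i)
      (hv.coordDeriv j) p (a := p) (b := p - 2) one_half_pos (by ring) i
    norm_num at h3
    linarith [(abs_le.1 h3).1]
  have hsum1 : ∀ i, ∑ j, weightedInner (fun x => ‖x‖ ^ p) (coordDeriv i (coordDeriv i v))
        (coordDeriv j (coordDeriv j v)) = weightedInner (fun x => ‖x‖ ^ p) (Δ v)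
          (coordDeriv i (coordDeriv i v)) := by
    intro i
    simp_rw [weightedInner_comm _ (coordDeriv i (coordDeriv i v))]
    rw [← weightedInner_sum_left ((hv.coordDeriv i).coordDeriv i) (continuousOn_norm_rpow p),
      ← laplacian_eq_sum_coordDeriv]
  have hsum1' : ∑ i, ∑ j, weightedInner (fun x => ‖x‖ ^ p) (coordDeriv i (coordDeriv i v))
        (coordDeriv j (coordDeriv j v)) = powerEnergy p (Δ v) := by
    simp_rw [hsum1, weightedInner_comm _ (Δ v)]
    rw [← weightedInner_sum_left hv.laplacian (continuousOn_norm_rpow p),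
      ← laplacian_eq_sum_coordDeriv, weightedInner_self]
  have hsum2 : ∑ i, ∑ j, weightedInner (fun x => p * ‖x‖ ^ (p - 2) * x j)
        (coordDeriv i (coordDeriv i v)) (coordDeriv j v) ≤
      N * powerEnergy p (Δ v) + p ^ 2 / 4 * ∑ j, powerEnergy (p - 2) (coordDeriv j v) := by
    rw [Finset.sum_comm]
    have : ∀ j, ∑ i, weightedInner (fun x => p * ‖x‖ ^ (p - 2) * x j)
        (coordDeriv i (coordDeriv i v)) (coordDeriv j v) ≤
        powerEnergy p (Δ v) + p ^ 2 / 4 * powerEnergy (p - 2) (coordDeriv j v) := by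
      intro j
      rw [← weightedInner_sum_left (hv.coordDeriv j) (continuousOn_coord_rpow p (p - 2) j),
        ← laplacian_eq_sum_coordDeriv]
      have h3 := abs_weightedInner_coord_rpow_le hv.laplacian (hv.coordDeriv j) p
        (a := p) (b := p - 2) one_pos (by ring) j
      simp only [one_mul, mul_one] at h3
      exact (le_abs_self _).trans h3
    refine (Finset.sum_le_sum fun j _ => this j).trans (le_of_eq ?_)
    rw [Finset.sum_add_distrib, Finset.sum_const, Finset.card_univ, Fintype.card_fin,
      nsmul_eq_mul, ← Finset.mul_sum]
  have h := Finset.sum_le_sum fun i (_ : i ∈ Finset.univ) =>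
    Finset.sum_le_sum fun j (_ : j ∈ Finset.univ) => hij i j
  simp only [Finset.sum_add_distrib, ← Finset.mul_sum, Finset.sum_const, Finset.card_univ,
    Fintype.card_fin, nsmul_eq_mul] at h
  rw [hsum1'] at h
  have hS : 0 ≤ p ^ 2 * ∑ j, powerEnergy (p - 2) (coordDeriv j v) :=
    mul_nonneg (sq_nonneg _) (Finset.sum_nonneg fun j _ => powerEnergy_nonneg _ _)
  linarith

/-- The cross term in `∫ |Au|²`: up to lower order terms `∫ |x|^p ⟪u, Δ²u⟫` is nonnegative, since
two integrations by parts turn it into `∫ |x|^p |Δu|²` plus terms with derivatives of the weight. -/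
theorem exists_neg_le_weightedInner_laplacian_laplacian (N : ℕ) (p : ℝ) :
    ∃ C : ℝ, 0 ≤ C ∧ ∀ u : 𝓢(EuclideanSpace ℝ (Fin N), ℂ), IsTest u →
      -(C * powerEnergy (p - 4) u) ≤ weightedInner (fun x => ‖x‖ ^ p) u (Δ (Δ u)) := by
  -- `ε` and `η` are small enough for the error terms to be absorbed in `∫ |x|^p |Δu|²`
  set ε : ℝ := 1 / (6 * (N + 1)) with hε
  have hε0 : 0 < ε := by positivity
  have hNε : 3 * N * ε ≤ 1 / 2 := by
    rw [hε, mul_one_div, div_le_iff₀ (by positivity)]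
    linarith
  set η : ℝ := ε / (p ^ 2 + 1) with hη
  have hη0 : 0 < η := by positivity
  have hpη : p ^ 2 / (2 * ε) * η ≤ 1 / 2 := by
    rw [hη, div_mul_div_comm, div_le_div_iff₀ (by positivity) (by positivity)]
    nlinarith
  set c : ℝ := |p| * (|p - 2| + 1) with hc
  refine ⟨p ^ 2 / (2 * ε) * (1 / η + N * (p - 2) ^ 2) + N * (c ^ 2 / (4 * ε)), by positivity,
    fun u hu => ?_⟩
  set f := Δ u with hf
  have hft : IsTest f := hu.laplacian
  have hwc : ∀ i, ContinuousOn (fun x : EuclideanSpace ℝ (Fin N) =>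
      p * ((p - 2) * ‖x‖ ^ (p - 2 - 2) * x i ^ 2 + ‖x‖ ^ (p - 2))) {0}ᶜ := fun i => by
    have := continuousOn_norm_rpow (N := N) (p - 2)
    have := continuousOn_norm_rpow (N := N) (p - 2 - 2)
    fun_prop
  have hX : ∀ i, weightedInner (fun x => ‖x‖ ^ p) (coordDeriv i (coordDeriv i u)) f
      - 3 * ε * powerEnergy p f - p ^ 2 / (2 * ε) * powerEnergy (p - 2) (coordDeriv i u)
      - c ^ 2 / (4 * ε) * powerEnergy (p - 4) u ≤
      weightedInner (fun x => ‖x‖ ^ p) u (coordDeriv i (coordDeriv i f)) := by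
    intro i
    have h1 := weightedInner_rpow_coordDeriv (f := u) (hft.coordDeriv i) p i
    have h2 := weightedInner_rpow_coordDeriv (f := coordDeriv i u) hft p i
    have h3 := weightedInner_coord_rpow_coordDeriv (f := u) hft p (p - 2) i
    have h4 := abs_weightedInner_coord_rpow_le hft (hu.coordDeriv i) p
      (a := p) (b := p - 2) hε0 (by ring) i
    rw [weightedInner_comm] at h4
    have h5 := abs_weightedInner_le hft hu (hwc i) (a := p) (b := p - 4)
      (by positivity : 0 ≤ c) hε0 fun x hx => by
        have hx' : 0 < ‖x‖ := norm_pos_iff.2 hx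
        have e1 : (p + (p - 4)) / 2 = p - 2 := by ring
        have e2 : ‖x‖ ^ (p - 2 - 2) * ‖x‖ ^ 2 = ‖x‖ ^ (p - 2) := by
          rw [← Real.rpow_natCast, ← Real.rpow_add hx']; norm_num
        have e3 : x i ^ 2 ≤ ‖x‖ ^ 2 := by
          rw [← sq_abs]; gcongr; exact abs_coord_le_norm x i
        rw [e1, hc, abs_mul, mul_assoc |p|]
        refine mul_le_mul_of_nonneg_left ?_ (abs_nonneg p)
        calc _ ≤ |(p - 2) * ‖x‖ ^ (p - 2 - 2) * x i ^ 2| + |‖x‖ ^ (p - 2)| := abs_add_le _ _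
          _ = |p - 2| * (‖x‖ ^ (p - 2 - 2) * x i ^ 2) + ‖x‖ ^ (p - 2) := by
            rw [abs_mul, abs_mul, abs_of_nonneg (by positivity : 0 ≤ ‖x‖ ^ (p - 2 - 2)),
              abs_of_nonneg (by positivity : 0 ≤ x i ^ 2),
              abs_of_nonneg (by positivity : 0 ≤ ‖x‖ ^ (p - 2)), mul_assoc]
          _ ≤ |p - 2| * (‖x‖ ^ (p - 2 - 2) * ‖x‖ ^ 2) + ‖x‖ ^ (p - 2) := by gcongr
          _ = _ := by rw [e2]; ring
    rw [weightedInner_comm] at h5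
    have e : p ^ 2 / (2 * ε) = 2 * (p ^ 2 / (4 * ε)) := by field_simp; norm_num
    rw [e]
    linarith [(abs_le.1 h4).1, (abs_le.1 h5).1]
  have hsum := Finset.sum_le_sum fun i (_ : i ∈ Finset.univ) => hX i
  have hgrad := sum_powerEnergy_coordDeriv_le hu (p - 2) hη0
  simp only [sub_add_cancel] at hgrad
  rw [show p - 2 - 2 = p - 4 by ring, ← hf] at hgrad
  have hR : ∑ i, weightedInner (fun x => ‖x‖ ^ p) u (coordDeriv i (coordDeriv i f)) =
      weightedInner (fun x => ‖x‖ ^ p) u (Δ f) := by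
    simp_rw [weightedInner_comm _ u]
    rw [← weightedInner_sum_left hu (continuousOn_norm_rpow p), ← laplacian_eq_sum_coordDeriv]
  rw [hR] at hsum
  simp only [Finset.sum_sub_distrib, ← Finset.mul_sum, Finset.sum_const, Finset.card_univ,
    Fintype.card_fin, nsmul_eq_mul] at hsum
  rw [← weightedInner_sum_left hft (continuousOn_norm_rpow p), ← laplacian_eq_sum_coordDeriv,
    ← hf, weightedInner_self] at hsum
  have hE := powerEnergy_nonneg p f
  have hgrad' := mul_le_mul_of_nonneg_left hgrad (by positivity : 0 ≤ p ^ 2 / (2 * ε))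
  nlinarith [mul_le_mul_of_nonneg_right hNε hE, mul_le_mul_of_nonneg_right hpη hE]

/-! ### Weighted estimates of fourth order -/

/-- The weighted energy `∫ |x|^p |D^k f|²` of the tensor of derivatives of order `k`. -/
def derivEnergy (k : ℕ) (p : ℝ) (f : 𝓢(EuclideanSpace ℝ (Fin N), ℂ)) : ℝ :=
  ∑ m : Fin k → Fin N, powerEnergy p (schPartial (List.ofFn m) f)

theorem derivEnergy_nonneg (k : ℕ) (p : ℝ) (f : 𝓢(EuclideanSpace ℝ (Fin N), ℂ)) :
    0 ≤ derivEnergy k p f := Finset.sum_nonneg fun _ _ => powerEnergy_nonneg _ _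

theorem derivEnergy_zero (p : ℝ) (f : 𝓢(EuclideanSpace ℝ (Fin N), ℂ)) :
    derivEnergy 0 p f = powerEnergy p f := by
  simp [derivEnergy]

theorem sum_fin_succ_eq {k : ℕ} (F : List (Fin N) → ℝ) :
    ∑ m : Fin (k + 1) → Fin N, F (List.ofFn m) =
      ∑ m : Fin k → Fin N, ∑ i, F (i :: List.ofFn m) := by
  rw [← (Fin.consEquiv fun _ => Fin N).sum_comp, Fintype.sum_prod_type, Finset.sum_comm]
  simp [Fin.consEquiv, List.ofFn_succ]

theorem derivEnergy_succ (k : ℕ) (p : ℝ) (f : 𝓢(EuclideanSpace ℝ (Fin N), ℂ)) :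
    derivEnergy (k + 1) p f =
      ∑ m : Fin k → Fin N, ∑ i, powerEnergy p (coordDeriv i (schPartial (List.ofFn m) f)) :=
  sum_fin_succ_eq fun l => powerEnergy p (schPartial l f)

theorem derivEnergy_succ_succ (k : ℕ) (p : ℝ) (f : 𝓢(EuclideanSpace ℝ (Fin N), ℂ)) :
    derivEnergy (k + 2) p f = ∑ m : Fin k → Fin N, ∑ i, ∑ j,
      powerEnergy p (coordDeriv i (coordDeriv j (schPartial (List.ofFn m) f))) := by
  rw [derivEnergy_succ,
    sum_fin_succ_eq fun l => ∑ i, powerEnergy p (coordDeriv i (schPartial l f))]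
  refine Finset.sum_congr rfl fun m _ => ?_
  rw [Finset.sum_comm]
  rfl

theorem schPartial_laplacian (l : List (Fin N)) (f : 𝓢(EuclideanSpace ℝ (Fin N), ℂ)) :
    schPartial l (Δ f) = Δ (schPartial l f) := by
  induction l with
  | nil => rfl
  | cons i l ih => rw [schPartial_cons, ih, coordDeriv_laplacian, schPartial_cons]

theorem derivEnergy_succ_le {f : 𝓢(EuclideanSpace ℝ (Fin N), ℂ)} (hf : IsTest f) (k : ℕ) (p : ℝ)
    {ε : ℝ} (hε : 0 < ε) :
    derivEnergy (k + 1) p f ≤ ε * derivEnergy (k + 2) (p + 2) f +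
      N * (1 / ε + p ^ 2) * derivEnergy k (p - 2) f := by
  rw [derivEnergy_succ, derivEnergy_succ_succ, derivEnergy, Finset.mul_sum, Finset.mul_sum,
    ← Finset.sum_add_distrib]
  refine Finset.sum_le_sum fun m _ => ?_
  calc _ ≤ ∑ i : Fin N, (ε * ∑ j, powerEnergy (p + 2)
        (coordDeriv i (coordDeriv j (schPartial (List.ofFn m) f))) +
        (1 / ε + p ^ 2) * powerEnergy (p - 2) (schPartial (List.ofFn m) f)) := by
        refine Finset.sum_le_sum fun i _ => ?_
        refine (powerEnergy_coordDeriv_le (hf.schPartial _) p hε i).trans ?_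
        gcongr
        exact Finset.single_le_sum (f := fun j => powerEnergy (p + 2)
          (coordDeriv i (coordDeriv j (schPartial (List.ofFn m) f))))
          (fun j _ => powerEnergy_nonneg _ _) (Finset.mem_univ i)
    _ = _ := by
        rw [Finset.sum_add_distrib, ← Finset.mul_sum, Finset.sum_const, Finset.card_univ,
          Fintype.card_fin, nsmul_eq_mul, mul_assoc]

theorem derivEnergy_succ_succ_le {f : 𝓢(EuclideanSpace ℝ (Fin N), ℂ)} (hf : IsTest f) (k : ℕ)
    (p : ℝ) :
    derivEnergy (k + 2) p f ≤ 2 * (1 + N) * derivEnergy k p (Δ f) +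
      (1 + N) * p ^ 2 * derivEnergy (k + 1) (p - 2) f := by
  rw [derivEnergy_succ_succ, derivEnergy_succ, derivEnergy, Finset.mul_sum, Finset.mul_sum,
    ← Finset.sum_add_distrib]
  refine Finset.sum_le_sum fun m _ => ?_
  rw [schPartial_laplacian]
  exact sum_powerEnergy_coordDeriv_coordDeriv_le (hf.schPartial _) p

theorem powerEnergy_laplacian_le {f : 𝓢(EuclideanSpace ℝ (Fin N), ℂ)} (hf : IsTest f) (p : ℝ) :
    powerEnergy p (Δ f) ≤ N * ∑ i, ∑ j, powerEnergy p (coordDeriv i (coordDeriv j f)) := by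
  have h1 : powerEnergy p (Δ f) ≤ N * ∑ i, powerEnergy p (coordDeriv i (coordDeriv i f)) := by
    have hi : ∀ i, Integrable fun x => ‖x‖ ^ p * ‖coordDeriv i (coordDeriv i f) x‖ ^ 2 :=
      fun i => ((hf.coordDeriv i).coordDeriv i).integrable_power p
    unfold powerEnergy
    rw [← integral_finsetSum _ fun i _ => hi i, ← integral_const_mul]
    refine integral_mono (hf.laplacian.integrable_power p)
      ((integrable_finsetSum _ fun i _ => hi i).const_mul _) fun x => ?_
    simp only []
    rw [laplacian_eq_sum_coordDeriv, sum_apply, ← Finset.mul_sum, mul_left_comm]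
    gcongr
    have h2 := norm_sum_le Finset.univ fun i => coordDeriv i (coordDeriv i f) x
    have h3 := sq_sum_le_card_mul_sum_sq (s := Finset.univ)
      (f := fun i => ‖coordDeriv i (coordDeriv i f) x‖)
    rw [Finset.card_univ, Fintype.card_fin] at h3
    exact (pow_le_pow_left₀ (norm_nonneg _) h2 2).trans h3
  refine h1.trans ?_
  gcongr with i _
  exact Finset.single_le_sum (f := fun j => powerEnergy p (coordDeriv i (coordDeriv j f)))
    (fun j _ => powerEnergy_nonneg _ _) (Finset.mem_univ i)

theorem derivEnergy_laplacian_le {f : 𝓢(EuclideanSpace ℝ (Fin N), ℂ)} (hf : IsTest f) (k : ℕ)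
    (p : ℝ) : derivEnergy k p (Δ f) ≤ N * derivEnergy (k + 2) p f := by
  rw [derivEnergy_succ_succ, derivEnergy, Finset.mul_sum]
  refine Finset.sum_le_sum fun m _ => ?_
  rw [schPartial_laplacian]
  exact powerEnergy_laplacian_le (hf.schPartial _) p

/-- Interpolation along a chain: if each term is controlled by a small multiple of the next one and
a multiple of the previous one, then all are controlled by the two ends. -/
theorem exists_chain_le {c₁ c₂ c₃ : ℝ → ℝ} (h₁ : ∀ η, 0 < η → 0 ≤ c₁ η)
    (h₂ : ∀ η, 0 < η → 0 ≤ c₂ η) (h₃ : ∀ η, 0 < η → 0 ≤ c₃ η) {ε : ℝ} (hε : 0 < ε) :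
    ∃ K, 0 ≤ K ∧ ∀ s₀ s₁ s₂ s₃ s₄ : ℝ, 0 ≤ s₀ → 0 ≤ s₁ → 0 ≤ s₂ → 0 ≤ s₃ → 0 ≤ s₄ →
      (∀ η, 0 < η → s₁ ≤ η * s₂ + c₁ η * s₀) → (∀ η, 0 < η → s₂ ≤ η * s₃ + c₂ η * s₁) →
      (∀ η, 0 < η → s₃ ≤ η * s₄ + c₃ η * s₂) →
      s₃ ≤ ε * s₄ + K * s₀ ∧ s₂ ≤ ε * s₄ + K * s₀ ∧ s₁ ≤ ε * s₄ + K * s₀ := by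
  -- one step of absorption
  have step : ∀ (a b : ℝ → ℝ), (∀ η, 0 < η → 0 ≤ a η) → (∀ η, 0 < η → 0 ≤ b η) →
      ∃ d : ℝ → ℝ, (∀ η, 0 < η → 0 ≤ d η) ∧ ∀ s t u v : ℝ, 0 ≤ s → 0 ≤ t → 0 ≤ u → 0 ≤ v →
        (∀ η, 0 < η → t ≤ η * u + a η * s) → (∀ η, 0 < η → u ≤ η * v + b η * t) →
        ∀ η, 0 < η → u ≤ η * v + d η * s := by
    intro a b ha hb
    refine ⟨fun η => 2 * (b (η / 2) * a (1 / (2 * (b (η / 2) + 1)))), fun η hη => ?_, ?_⟩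
    · have hb' := hb (η / 2) (half_pos hη)
      have := ha (1 / (2 * (b (η / 2) + 1))) (by positivity)
      positivity
    · intro s t u v hs ht hu hv h1 h2 η hη
      have hb' := hb (η / 2) (half_pos hη)
      set B := b (η / 2)
      have hB : B * (1 / (2 * (B + 1))) ≤ 1 / 2 := by
        rw [mul_one_div, div_le_div_iff₀ (by positivity) (by positivity)]
        linarith
      have e1 := h1 (1 / (2 * (B + 1))) (by positivity)
      have e2 := h2 (η / 2) (half_pos hη)
      have e3 := mul_le_mul_of_nonneg_left e1 hb'
      have e4 := mul_le_mul_of_nonneg_right hB hu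
      simp only []
      linarith
  obtain ⟨d₂, hd₂, hd₂'⟩ := step c₁ c₂ h₁ h₂
  obtain ⟨d₃, hd₃, hd₃'⟩ := step d₂ c₃ hd₂ h₃
  have H3 := hd₃ ε hε
  have H2 := hd₂ 1 one_pos
  have H1 := h₁ 1 one_pos
  refine ⟨d₃ ε + d₂ 1 + c₁ 1, by positivity, ?_⟩
  intro s₀ s₁ s₂ s₃ s₄ p0 p1 p2 p3 p4 g1 g2 g3
  have k2 := hd₂' s₀ s₁ s₂ s₃ p0 p1 p2 p3 g1 g2
  have k3 := hd₃' s₀ s₂ s₃ s₄ p0 p2 p3 p4 k2 g3 ε hε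
  have k2' := k2 1 one_pos
  have k1' := g1 1 one_pos
  have q1 := mul_nonneg H1 p0
  have q2 := mul_nonneg H2 p0
  have q3 := mul_nonneg H3 p0
  refine ⟨?_, ?_, ?_⟩ <;> linarith

/-- Interpolation between the weighted function and its weighted fourth derivatives. -/
theorem exists_derivEnergy_interpolation (N : ℕ) (p : ℝ) {ε : ℝ} (hε : 0 < ε) :
    ∃ K, 0 ≤ K ∧ ∀ f : 𝓢(EuclideanSpace ℝ (Fin N), ℂ), IsTest f →
      derivEnergy 3 (p - 2) f ≤ ε * derivEnergy 4 p f + K * derivEnergy 0 (p - 8) f ∧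
      derivEnergy 2 (p - 4) f ≤ ε * derivEnergy 4 p f + K * derivEnergy 0 (p - 8) f ∧
      derivEnergy 1 (p - 6) f ≤ ε * derivEnergy 4 p f + K * derivEnergy 0 (p - 8) f := by
  obtain ⟨K, hK0, hK⟩ := exists_chain_le (c₁ := fun η => N * (1 / η + (p - 6) ^ 2))
    (c₂ := fun η => N * (1 / η + (p - 4) ^ 2)) (c₃ := fun η => N * (1 / η + (p - 2) ^ 2))
    (fun η hη => by positivity) (fun η hη => by positivity) (fun η hη => by positivity) hε
  refine ⟨K, hK0, fun f hf => hK _ _ _ _ _ (derivEnergy_nonneg _ _ _) (derivEnergy_nonneg _ _ _)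
    (derivEnergy_nonneg _ _ _) (derivEnergy_nonneg _ _ _) (derivEnergy_nonneg _ _ _)
    (fun η hη => ?_) (fun η hη => ?_) (fun η hη => ?_)⟩
  · convert derivEnergy_succ_le hf 0 (p - 6) hη using 4 <;> ring
  · convert derivEnergy_succ_le hf 1 (p - 4) hη using 4 <;> ring
  · convert derivEnergy_succ_le hf 2 (p - 2) hη using 4 <;> ring

theorem derivEnergy_four_le {f : 𝓢(EuclideanSpace ℝ (Fin N), ℂ)} (hf : IsTest f) (p : ℝ) :
    derivEnergy 4 p f ≤ (2 * (1 + N)) ^ 2 * powerEnergy p (Δ (Δ f)) +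
      (1 + N) * (1 + 2 * (1 + N) * N) * p ^ 2 * derivEnergy 3 (p - 2) f := by
  have h1 := derivEnergy_succ_succ_le hf 2 p
  have h2 := derivEnergy_succ_succ_le hf.laplacian 0 p
  have h3 := derivEnergy_laplacian_le hf 1 (p - 2)
  rw [derivEnergy_zero] at h2
  norm_num only at h1 h2 h3
  have h2' := mul_le_mul_of_nonneg_left h2 (by positivity : (0 : ℝ) ≤ 2 * (1 + N))
  have h3' := mul_le_mul_of_nonneg_left h3
    (by positivity : (0 : ℝ) ≤ 2 * (1 + N) * ((1 + N) * p ^ 2))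
  linarith

/-- The unweighted Calderón–Zygmund estimate `‖D⁴ f‖ ≤ C ‖Δ² f‖`. -/
theorem derivEnergy_four_zero_le {f : 𝓢(EuclideanSpace ℝ (Fin N), ℂ)} (hf : IsTest f) :
    derivEnergy 4 0 f ≤ (2 * (1 + N)) ^ 2 * powerEnergy 0 (Δ (Δ f)) := by
  simpa using derivEnergy_four_le hf 0

/-- The weighted Calderón–Zygmund estimate. -/
theorem exists_derivEnergy_le (N : ℕ) (p : ℝ) :
    ∃ K, 0 ≤ K ∧ ∀ f : 𝓢(EuclideanSpace ℝ (Fin N), ℂ), IsTest f → ∀ k ≤ 4,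
      derivEnergy k (p - 2 * (4 - k)) f ≤
        K * (powerEnergy p (Δ (Δ f)) + powerEnergy (p - 8) f) := by
  set A : ℝ := (1 + N) * (1 + 2 * (1 + N) * N) * p ^ 2 with hA
  have hA0 : 0 ≤ A := by positivity
  set B : ℝ := (2 * (1 + N)) ^ 2 with hB
  have hB0 : 0 ≤ B := by positivity
  obtain ⟨K, hK0, hK⟩ := exists_derivEnergy_interpolation N p
    (by positivity : 0 < 1 / (2 * (A + 1)))
  have hAε : A * (1 / (2 * (A + 1))) ≤ 1 / 2 := by
    rw [mul_one_div, div_le_div_iff₀ (by positivity) (by positivity)]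
    linarith
  have hε1 : 1 / (2 * (A + 1)) ≤ 1 := by
    rw [div_le_one (by positivity)]; linarith
  refine ⟨2 * B + 2 * A * K + K + 1, by positivity, fun f hf k hk => ?_⟩
  obtain ⟨h3, h2, h1⟩ := hK f hf
  have h4 := derivEnergy_four_le hf p
  rw [derivEnergy_zero] at h1 h2 h3
  rw [← hA, ← hB] at h4
  have p4 := derivEnergy_nonneg 4 p f
  have p0 := powerEnergy_nonneg (p - 8) f
  have pf := powerEnergy_nonneg p (Δ (Δ f))
  have h3' := mul_le_mul_of_nonneg_left h3 hA0
  have e1 := mul_le_mul_of_nonneg_right hAε p4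
  have e2 := mul_le_mul_of_nonneg_right hε1 p4
  have b1 := mul_nonneg hB0 pf
  have b2 := mul_nonneg hB0 p0
  have b3 := mul_nonneg (mul_nonneg hA0 hK0) pf
  have b4 := mul_nonneg (mul_nonneg hA0 hK0) p0
  have b5 := mul_nonneg hK0 pf
  have b6 := mul_nonneg hK0 p0
  have h4' : derivEnergy 4 p f ≤ 2 * B * powerEnergy p (Δ (Δ f)) +
      2 * A * K * powerEnergy (p - 8) f := by linarith
  interval_cases k
  · norm_num [derivEnergy_zero]; linarith
  · norm_num; linarith
  · norm_num; linarith
  · norm_num; linarith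
  · norm_num; linarith

/-! ### The a priori estimates for test functions -/

theorem IsTest.hasCompactSupport_rpow_smul {f : 𝓢(EuclideanSpace ℝ (Fin N), ℂ)} (hf : IsTest f)
    (s : ℝ) : HasCompactSupport fun x => ‖x‖ ^ s • f x :=
  hf.1.of_isClosed_subset (isClosed_tsupport _) (tsupport_smul_subset_right _ _)

theorem IsTest.continuous_rpow_smul {f : 𝓢(EuclideanSpace ℝ (Fin N), ℂ)} (hf : IsTest f)
    (s : ℝ) : Continuous fun x => ‖x‖ ^ s • f x := by
  have hsub : tsupport (fun x => ‖x‖ ^ s • f x) ⊆ tsupport f := tsupport_smul_subset_right _ _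
  refine ContinuousOn.continuous_of_tsupport_subset (s := {0}ᶜ) ?_ isOpen_compl_singleton
    fun x hx h0 => hf.2 ?_
  · exact (continuousOn_norm_rpow s).smul f.continuous.continuousOn
  · rw [Set.mem_singleton_iff.1 h0] at hx
    exact hsub hx

theorem IsTest.memLp_rpow_smul {f : 𝓢(EuclideanSpace ℝ (Fin N), ℂ)} (hf : IsTest f) (s : ℝ) :
    MemLp (fun x => ‖x‖ ^ s • f x) 2 volume :=
  (hf.continuous_rpow_smul s).memLp_of_hasCompactSupport (hf.hasCompactSupport_rpow_smul s)

theorem weightedNorm_toLp (s : ℝ) (l : List (Fin N)) (f : 𝓢(EuclideanSpace ℝ (Fin N), ℂ)) :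
    weightedNorm s l (f.toLp 2 volume) =
      eLpNorm (fun x => ‖x‖ ^ s • schPartial l f x) 2 volume := by
  rw [weightedNorm, weakPartial_toLp]
  refine eLpNorm_congr_ae ?_
  filter_upwards [(schPartial l f).coeFn_toLp 2 volume] with x hx
  rw [hx]

theorem norm_rpow_smul_sq (x : EuclideanSpace ℝ (Fin N)) (s : ℝ) (z : ℂ) :
    ‖‖x‖ ^ s • z‖ ^ 2 = ‖x‖ ^ (2 * s) * ‖z‖ ^ 2 := by
  rw [norm_smul, mul_pow, Real.norm_eq_abs, sq_abs, ← Real.rpow_natCast,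
    ← Real.rpow_mul (norm_nonneg _)]
  congr 2
  push_cast
  ring

theorem IsTest.weightedNorm_eq {f : 𝓢(EuclideanSpace ℝ (Fin N), ℂ)} (hf : IsTest f)
    (s : ℝ) (l : List (Fin N)) :
    weightedNorm s l (f.toLp 2 volume) =
      ENNReal.ofReal (Real.sqrt (powerEnergy (2 * s) (_root_.schPartial l f))) := by
  rw [weightedNorm_toLp, eLpNorm_two_eq_sqrt_integral ((hf.schPartial l).memLp_rpow_smul s)]
  simp_rw [norm_rpow_smul_sq]
  rfl

theorem powerEnergy_le_derivEnergy (k : ℕ) (p : ℝ) (f : 𝓢(EuclideanSpace ℝ (Fin N), ℂ))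
    {l : List (Fin N)} (hl : l.length = k) : powerEnergy p (schPartial l f) ≤ derivEnergy k p f := by
  subst hl
  have := Finset.single_le_sum (f := fun m : Fin l.length → Fin N =>
    powerEnergy p (schPartial (List.ofFn m) f)) (fun _ _ => powerEnergy_nonneg _ _)
    (Finset.mem_univ l.get)
  rw [List.ofFn_get] at this
  exact this

/-- Rellich's inequality `‖|x|^{-4} f‖₂ ≤ C ‖D⁴ f‖₂`. -/
theorem powerEnergy_neg_eight_le (hN : 8 < N) {f : 𝓢(EuclideanSpace ℝ (Fin N), ℂ)}
    (hf : IsTest f) : powerEnergy (-8) f ≤ (2 * N) ^ 8 * derivEnergy 4 0 f := by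
  have h := weightedNorm_le_of_norm_le hN (memSobolev_toLp f 4) (l := []) (by simp)
    (K := Real.sqrt (derivEnergy 4 0 f)) (Real.sqrt_nonneg _) fun m hm => by
      rw [weakPartial_toLp, SchwartzMap.norm_toLp,
        eLpNorm_two_eq_sqrt_integral ((schPartial m f).memLp 2 volume),
        ENNReal.toReal_ofReal (Real.sqrt_nonneg _)]
      apply Real.sqrt_le_sqrt
      simpa [powerEnergy] using powerEnergy_le_derivEnergy 4 0 f hm
  rw [hf.weightedNorm_eq, ENNReal.ofReal_le_ofReal_iff (by positivity),
    Real.sqrt_le_left (by positivity), mul_pow, Real.sq_sqrt (derivEnergy_nonneg _ _ _),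
    ← pow_mul] at h
  norm_num at h
  exact h

/-- An intermediate power is dominated by small multiples of two extreme ones and a constant. -/
theorem exists_rpow_le {a p b ε : ℝ} (hap : a < p) (hpb : p < b) (hε : 0 < ε) :
    ∃ C, 0 ≤ C ∧ ∀ t : ℝ, 0 < t → t ^ p ≤ ε * t ^ a + ε * t ^ b + C := by
  have hpa : 0 < p - a := sub_pos.2 hap
  have hbp : 0 < b - p := sub_pos.2 hpb
  set δ : ℝ := ε ^ (1 / (p - a)) with hδ
  set R : ℝ := (ε⁻¹) ^ (1 / (b - p)) with hR
  have hδ0 : 0 < δ := by positivity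
  have hR0 : 0 < R := by positivity
  refine ⟨δ ^ p + R ^ p, by positivity, fun t ht => ?_⟩
  have h1 : 0 < t ^ a := by positivity
  have h2 : 0 < t ^ b := by positivity
  have h3 : 0 < δ ^ p := by positivity
  have h4 : 0 < R ^ p := by positivity
  rcases le_or_gt t δ with h | h
  · have : t ^ (p - a) ≤ ε := by
      calc t ^ (p - a) ≤ δ ^ (p - a) := by gcongr
        _ = ε := by rw [hδ, ← Real.rpow_mul hε.le, one_div_mul_cancel hpa.ne', Real.rpow_one]
    have e : t ^ p = t ^ (p - a) * t ^ a := by rw [← Real.rpow_add ht]; ring_nf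
    have := mul_le_mul_of_nonneg_right this h1.le
    have := mul_pos hε h2
    linarith
  rcases le_or_gt R t with h' | h'
  · have : (t ^ (b - p))⁻¹ ≤ ε := by
      rw [inv_le_comm₀ (by positivity) hε]
      calc ε⁻¹ = R ^ (b - p) := by
            rw [hR, ← Real.rpow_mul (by positivity), one_div_mul_cancel hbp.ne', Real.rpow_one]
        _ ≤ t ^ (b - p) := by gcongr
    have e : t ^ p = (t ^ (b - p))⁻¹ * t ^ b := by
      rw [← Real.rpow_neg ht.le, ← Real.rpow_add ht]; ring_nf
    have := mul_le_mul_of_nonneg_right this h2.le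
    have := mul_pos hε h1
    linarith
  · have : t ^ p ≤ δ ^ p + R ^ p := by
      rcases le_total 0 p with hp | hp
      · have : t ^ p ≤ R ^ p := by gcongr
        linarith
      · have : t ^ p ≤ δ ^ p := Real.rpow_le_rpow_of_nonpos hδ0 h.le hp
        linarith
    have := mul_pos hε h1
    have := mul_pos hε h2
    linarith

/-- `∫ (1 + |x|^α)⁴ |f|²`. -/
def diffusionEnergy (α : ℝ) (f : 𝓢(EuclideanSpace ℝ (Fin N), ℂ)) : ℝ :=
  ∫ x, (1 + ‖x‖ ^ α) ^ 4 * ‖f x‖ ^ 2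

/-- `‖A f‖₂²` for a test function `f`. -/
def opEnergy (α β : ℝ) (f : 𝓢(EuclideanSpace ℝ (Fin N), ℂ)) : ℝ :=
  ∫ x, ‖(1 + ‖x‖ ^ α) ^ 2 • Δ (Δ f) x + (‖x‖ ^ β) ^ 2 • f x‖ ^ 2

theorem IsTest.integrable_diffusion {f : 𝓢(EuclideanSpace ℝ (Fin N), ℂ)} (hf : IsTest f) (α : ℝ) :
    Integrable fun x => (1 + ‖x‖ ^ α) ^ 4 * ‖f x‖ ^ 2 := by
  have := continuousOn_norm_rpow (N := N) α
  simpa only [real_inner_self_eq_norm_sq] using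
    hf.integrable_mul_inner (f := f) (w := fun x => (1 + ‖x‖ ^ α) ^ 4) (by fun_prop)

theorem powerEnergy_zero_le_diffusionEnergy {f : 𝓢(EuclideanSpace ℝ (Fin N), ℂ)} (hf : IsTest f)
    (α : ℝ) : powerEnergy 0 f ≤ diffusionEnergy α f := by
  refine integral_mono (hf.integrable_power 0) (hf.integrable_diffusion α) fun x => ?_
  simp only [Real.rpow_zero]
  gcongr
  exact one_le_pow₀ (by linarith [Real.rpow_nonneg (norm_nonneg x) α])

theorem powerEnergy_four_mul_le_diffusionEnergy {f : 𝓢(EuclideanSpace ℝ (Fin N), ℂ)}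
    (hf : IsTest f) (α : ℝ) : powerEnergy (4 * α) f ≤ diffusionEnergy α f := by
  refine integral_mono (hf.integrable_power _) (hf.integrable_diffusion α) fun x => ?_
  simp only []
  rw [mul_comm 4 α, Real.rpow_mul (norm_nonneg _)]
  norm_cast
  have := Real.rpow_nonneg (norm_nonneg x) α
  gcongr
  linarith

/-- Expansion of `‖a² Δ² f + V² f‖₂²`; the weight `a² V²` of the cross term is a sum of three powers
of `|x|`. -/
theorem opEnergy_eq {f : 𝓢(EuclideanSpace ℝ (Fin N), ℂ)} (hf : IsTest f) (hN : 0 < N) (α β : ℝ) :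
    opEnergy α β f = diffusionEnergy α (Δ (Δ f)) + powerEnergy (4 * β) f +
      2 * (weightedInner (fun x => ‖x‖ ^ (2 * β)) f (Δ (Δ f)) +
        2 * weightedInner (fun x => ‖x‖ ^ (α + 2 * β)) f (Δ (Δ f)) +
        weightedInner (fun x => ‖x‖ ^ (2 * α + 2 * β)) f (Δ (Δ f))) := by
  have hg := hf.laplacian.laplacian
  have hI : ∀ p : ℝ, Integrable fun x => ‖x‖ ^ p * inner ℝ (f x) (Δ (Δ f) x) := fun p =>
    hg.integrable_mul_inner (continuousOn_norm_rpow p)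
  have hI2 : Integrable fun x => 2 * (‖x‖ ^ (α + 2 * β) * inner ℝ (f x) (Δ (Δ f) x)) :=
    (hI _).const_mul 2
  have hI12 : Integrable fun x => ‖x‖ ^ (2 * β) * inner ℝ (f x) (Δ (Δ f) x) +
      2 * (‖x‖ ^ (α + 2 * β) * inner ℝ (f x) (Δ (Δ f) x)) := (hI _).add hI2
  have hI123 : Integrable fun x => 2 * (‖x‖ ^ (2 * β) * inner ℝ (f x) (Δ (Δ f) x) +
      2 * (‖x‖ ^ (α + 2 * β) * inner ℝ (f x) (Δ (Δ f) x)) +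
      ‖x‖ ^ (2 * α + 2 * β) * inner ℝ (f x) (Δ (Δ f) x)) := (hI12.add (hI _)).const_mul 2
  have hD : Integrable fun x => (1 + ‖x‖ ^ α) ^ 4 * ‖Δ (Δ f) x‖ ^ 2 + ‖x‖ ^ (4 * β) * ‖f x‖ ^ 2 :=
    (hg.integrable_diffusion α).add (hf.integrable_power _)
  unfold weightedInner diffusionEnergy powerEnergy opEnergy
  rw [← integral_const_mul, ← integral_add (hI _) hI2, ← integral_add hI12 (hI _),
    ← integral_const_mul, ← integral_add (hg.integrable_diffusion α) (hf.integrable_power _),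
    ← integral_add hD hI123]
  refine integral_congr_ae ?_
  filter_upwards [ae_ne_zero hN] with x hx
  have hx' : 0 < ‖x‖ := norm_pos_iff.2 hx
  have e1 : ‖x‖ ^ (2 * β) = (‖x‖ ^ β) ^ 2 := by
    rw [mul_comm, Real.rpow_mul hx'.le]; norm_cast
  have e2 : ‖x‖ ^ (4 * β) = (‖x‖ ^ β) ^ 4 := by
    rw [mul_comm, Real.rpow_mul hx'.le]; norm_cast
  have e3 : ‖x‖ ^ (2 * α) = (‖x‖ ^ α) ^ 2 := by
    rw [mul_comm, Real.rpow_mul hx'.le]; norm_cast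
  rw [Real.rpow_add hx', Real.rpow_add hx', e1, e2, e3, norm_add_sq_real, norm_smul, norm_smul,
    real_inner_smul_left, real_inner_smul_right, real_inner_comm (Δ (Δ f) x) (f x),
    Real.norm_eq_abs, Real.norm_eq_abs, mul_pow, mul_pow, sq_abs, sq_abs]
  ring

theorem powerEnergy_le_of_rpow_le {f : 𝓢(EuclideanSpace ℝ (Fin N), ℂ)} (hf : IsTest f)
    {p a b A B C : ℝ} (h : ∀ t : ℝ, 0 < t → t ^ p ≤ A * t ^ a + B * t ^ b + C) :
    powerEnergy p f ≤ A * powerEnergy a f + B * powerEnergy b f + C * powerEnergy 0 f := by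
  have hI : ∀ c q : ℝ, Integrable fun x => c * (‖x‖ ^ q * ‖f x‖ ^ 2) := fun c q =>
    (hf.integrable_power q).const_mul c
  have hI2 : Integrable fun x => A * (‖x‖ ^ a * ‖f x‖ ^ 2) + B * (‖x‖ ^ b * ‖f x‖ ^ 2) :=
    (hI _ _).add (hI _ _)
  unfold powerEnergy
  rw [← integral_const_mul, ← integral_const_mul, ← integral_const_mul,
    ← integral_add (hI _ _) (hI _ _), ← integral_add hI2 (hI _ _)]
  refine integral_mono (hf.integrable_power _) (hI2.add (hI _ _)) fun x => ?_
  rcases eq_or_ne x 0 with rfl | hx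
  · simp [hf.apply_zero]
  · have := mul_le_mul_of_nonneg_right (h ‖x‖ (norm_pos_iff.2 hx)) (sq_nonneg ‖f x‖)
    simp only [Real.rpow_zero]
    linarith

/-- The two parts `a² Δ² f` and `V² f` of `A f` are separately controlled by `A f` and `f`. -/
theorem exists_separation (hN : 8 < N) {α β : ℝ} (hα : 0 < α) (hβ : max (α - 2) 0 < β) :
    ∃ C, 0 ≤ C ∧ ∀ f : 𝓢(EuclideanSpace ℝ (Fin N), ℂ), IsTest f →
      diffusionEnergy α (Δ (Δ f)) + powerEnergy (4 * β) f ≤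
        C * (opEnergy α β f + powerEnergy 0 f) := by
  obtain ⟨hβ1, hβ2⟩ := max_lt_iff.1 hβ
  obtain ⟨C₁, hC₁, h₁⟩ := exists_neg_le_weightedInner_laplacian_laplacian N (2 * β)
  obtain ⟨C₂, hC₂, h₂⟩ := exists_neg_le_weightedInner_laplacian_laplacian N (α + 2 * β)
  obtain ⟨C₃, hC₃, h₃⟩ := exists_neg_le_weightedInner_laplacian_laplacian N (2 * α + 2 * β)
  set H : ℝ := (2 * N) ^ 8 * (2 * (1 + N)) ^ 2 with hH
  have hH0 : 0 ≤ H := by positivity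
  set D : ℝ := 2 * C₁ + 4 * C₂ + 2 * C₃ with hD
  have hD0 : 0 ≤ D := by positivity
  -- small enough to absorb the lower order terms
  set ε : ℝ := 1 / (2 * (D + 1) * (H + 1)) with hε
  have hε0 : 0 < ε := by positivity
  -- `2α + 2β - 4 < 4β` is the condition `α - 2 < β`
  obtain ⟨K₁, hK₁, k₁⟩ := exists_rpow_le (a := -8) (p := 2 * β - 4) (b := 4 * β)
    (by linarith) (by linarith) hε0
  obtain ⟨K₂, hK₂, k₂⟩ := exists_rpow_le (a := -8) (p := α + 2 * β - 4) (b := 4 * β)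
    (by linarith) (by linarith) hε0
  obtain ⟨K₃, hK₃, k₃⟩ := exists_rpow_le (a := -8) (p := 2 * α + 2 * β - 4) (b := 4 * β)
    (by linarith) (by linarith) hε0
  refine ⟨2 + 2 * (2 * C₁ * K₁ + 4 * C₂ * K₂ + 2 * C₃ * K₃), by positivity, fun f hf => ?_⟩
  have hop := opEnergy_eq hf (by omega) α β
  have hO : 0 ≤ opEnergy α β f := integral_nonneg fun x => by positivity
  have hP : powerEnergy (-8) f ≤ H * diffusionEnergy α (Δ (Δ f)) := by
    have i1 := powerEnergy_neg_eight_le hN hf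
    have i2 := derivEnergy_four_zero_le hf
    have i3 := powerEnergy_zero_le_diffusionEnergy hf.laplacian.laplacian α
    calc _ ≤ _ := i1
      _ ≤ (2 * (N : ℝ)) ^ 8 * ((2 * (1 + N)) ^ 2 * diffusionEnergy α (Δ (Δ f))) := by
        gcongr
        exact i2.trans (by gcongr)
      _ = _ := by rw [hH]; ring
  set P := diffusionEnergy α (Δ (Δ f))
  have hP0 : 0 ≤ P := integral_nonneg fun x => by positivity
  set V := powerEnergy (4 * β) f
  have hV0 : 0 ≤ V := powerEnergy_nonneg _ _
  have hE := powerEnergy_nonneg 0 f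
  have q₁ := mul_le_mul_of_nonneg_left (powerEnergy_le_of_rpow_le hf k₁) hC₁
  have q₂ := mul_le_mul_of_nonneg_left (powerEnergy_le_of_rpow_le hf k₂) hC₂
  have q₃ := mul_le_mul_of_nonneg_left (powerEnergy_le_of_rpow_le hf k₃) hC₃
  have g₁ := h₁ f hf
  have g₂ := h₂ f hf
  have g₃ := h₃ f hf
  have hsum : P + V ≤ opEnergy α β f + D * (ε * powerEnergy (-8) f + ε * V) +
      (2 * C₁ * K₁ + 4 * C₂ * K₂ + 2 * C₃ * K₃) * powerEnergy 0 f := by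
    rw [hD]; linarith
  have habs : D * (ε * powerEnergy (-8) f + ε * V) ≤ 1 / 2 * (P + V) := by
    have s1 : powerEnergy (-8) f + V ≤ (H + 1) * (P + V) := by nlinarith
    calc D * (ε * powerEnergy (-8) f + ε * V) = D * ε * (powerEnergy (-8) f + V) := by ring
      _ ≤ (D + 1) * ε * ((H + 1) * (P + V)) := by
        have := powerEnergy_nonneg (-8) f
        gcongr
        linarith
      _ = _ := by rw [hε]; field_simp
  have t1 : 0 ≤ (2 * C₁ * K₁ + 4 * C₂ * K₂ + 2 * C₃ * K₃) * opEnergy α β f := by positivity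
  linarith

/-- The a priori estimates for test functions. -/
theorem exists_test_estimate (hN : 8 < N) {α β : ℝ} (hα : 0 < α) (hβ : max (α - 2) 0 < β) :
    ∃ C, 0 ≤ C ∧ ∀ f : 𝓢(EuclideanSpace ℝ (Fin N), ℂ), IsTest f →
      (∀ k ≤ 4, derivEnergy k (4 * α - 2 * (4 - k)) f ≤ C * (opEnergy α β f + powerEnergy 0 f)) ∧
      derivEnergy 4 0 f ≤ C * (opEnergy α β f + powerEnergy 0 f) ∧
      powerEnergy (4 * β) f ≤ C * (opEnergy α β f + powerEnergy 0 f) := by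
  obtain ⟨hβ1, hβ2⟩ := max_lt_iff.1 hβ
  obtain ⟨C, hC0, hC⟩ := exists_separation hN hα hβ
  obtain ⟨K, hK0, hK⟩ := exists_derivEnergy_le N (4 * α)
  set B : ℝ := (2 * (1 + N)) ^ 2 with hB
  have hB0 : 0 ≤ B := by positivity
  refine ⟨(K * (2 + (2 * N) ^ 8 * B) + B + 1) * C, by positivity, fun f hf => ?_⟩
  have hsep := hC f hf
  set G := opEnergy α β f + powerEnergy 0 f
  have hg := hf.laplacian.laplacian
  have hV0 := powerEnergy_nonneg (4 * β) f
  have hP0 : 0 ≤ diffusionEnergy α (Δ (Δ f)) := integral_nonneg fun x => by positivity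
  have hG0 : 0 ≤ C * G := by linarith
  have i1 := powerEnergy_neg_eight_le hN hf
  have i2 : derivEnergy 4 0 f ≤ B * (C * G) := by
    refine (derivEnergy_four_zero_le hf).trans ?_
    gcongr
    linarith [powerEnergy_zero_le_diffusionEnergy hg α]
  have i3 : powerEnergy (-8) f ≤ (2 * N) ^ 8 * B * (C * G) := by
    calc _ ≤ _ := i1
      _ ≤ (2 * (N : ℝ)) ^ 8 * (B * (C * G)) := by gcongr
      _ = _ := by ring
  have i4 : powerEnergy (4 * α - 8) f ≤ powerEnergy (-8) f + powerEnergy (4 * β) f := by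
    have := powerEnergy_le_of_rpow_le hf (p := 4 * α - 8) (a := -8) (b := 4 * β) (A := 1) (B := 1)
      (C := 0) fun t ht => by
        have p1 : 0 < t ^ (-8 : ℝ) := by positivity
        have p2 : 0 < t ^ (4 * β) := by positivity
        rcases le_total t 1 with h | h
        · have := Real.rpow_le_rpow_of_exponent_ge ht h (by linarith : (-8 : ℝ) ≤ 4 * α - 8)
          linarith
        · have := Real.rpow_le_rpow_of_exponent_le h (by linarith : 4 * α - 8 ≤ 4 * β)
          linarith
    linarith
  have i5 := powerEnergy_four_mul_le_diffusionEnergy hg α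
  have r1 : 0 ≤ K * (2 + (2 * (N : ℝ)) ^ 8 * B) * (C * G) := by positivity
  have r2 : 0 ≤ B * (C * G) := by positivity
  refine ⟨fun k hk => ?_, by linarith, by linarith⟩
  have i6 : powerEnergy (4 * α) (Δ (Δ f)) + powerEnergy (4 * α - 8) f ≤
      (2 + (2 * N) ^ 8 * B) * (C * G) := by linarith
  have := (hK f hf k hk).trans (mul_le_mul_of_nonneg_left i6 hK0)
  linarith

/-! ### The Leibniz rule -/

/-- The Leibniz sum `∑ c_a z_b` over all ways of splitting the list `l` into two complementary
sublists `a` and `b`. -/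
def leibnizSum {ι R : Type*} [Add R] [Mul R] : List ι → (List ι → R) → (List ι → R) → R
  | [], c, z => c [] * z []
  | i :: l, c, z => leibnizSum l (fun a => c (i :: a)) z + leibnizSum l c fun b => z (i :: b)

theorem leibnizSum_induction {ι R : Type*} [Add R] [Mul R] {P : R → Prop}
    (hadd : ∀ f g, P f → P g → P (f + g)) (l : List ι) (c z : List ι → R)
    (h : ∀ a b, a.length + b.length = l.length → P (c a * z b)) : P (leibnizSum l c z) := by
  induction l generalizing c z with
  | nil => exact h [] [] rfl
  | cons i l ih =>
    refine hadd _ _ (ih _ _ fun a b hab => h _ _ ?_) (ih _ _ fun a b hab => h _ _ ?_)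
    · simp only [List.length_cons]; omega
    · simp only [List.length_cons]; omega

theorem leibnizSum_apply {ι X R : Type*} [Add R] [Mul R] (l : List ι) (c z : List ι → X → R)
    (x : X) : leibnizSum l c z x = leibnizSum l (fun a => c a x) fun b => z b x := by
  induction l generalizing c z with
  | nil => rfl
  | cons i l ih => simp only [leibnizSum, Pi.add_apply, ih]

theorem leibnizSum_sub {ι R : Type*} [CommRing R] (l : List ι) (c z z' : List ι → R) :
    leibnizSum l c (fun b => z b - z' b) = leibnizSum l c z - leibnizSum l c z' := by
  induction l generalizing c z z' with
  | nil => simp [leibnizSum, mul_sub]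
  | cons i l ih => simp only [leibnizSum, ih]; ring

theorem leibnizSum_of_eq_ite {ι R : Type*} [CommRing R] (l : List ι) (c z : List ι → R)
    (hc : ∀ a : List ι, a.length ≤ l.length → c a = if a = [] then 1 else 0) :
    leibnizSum l c z = z l := by
  have h0 : ∀ (l : List ι) (c z : List ι → R), (∀ a : List ι, a.length ≤ l.length → c a = 0) →
      leibnizSum l c z = 0 := by
    intro l
    induction l with
    | nil => intro c z h; simp [leibnizSum, h [] le_rfl]
    | cons i l ih =>
      intro c z h
      rw [leibnizSum, ih _ _ fun a ha => h _ (by simpa using ha),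
        ih _ _ fun a ha => h _ (by simp; omega), add_zero]
  induction l generalizing c z with
  | nil => simp [leibnizSum, hc [] le_rfl]
  | cons i l ih =>
    rw [leibnizSum, ih c _ fun a ha => hc a (by simp; omega),
      h0 l _ z fun a ha => by simpa using hc (i :: a) (by simpa using ha), zero_add]

theorem norm_leibnizSum_le {ι : Type*} (l : List ι) (c z : List ι → ℂ) {C : List ι → ℝ}
    (hC : ∀ a, ‖c a‖ ≤ C a) : ‖leibnizSum l c z‖ ≤ leibnizSum l C fun b => ‖z b‖ := by
  induction l generalizing c z C with
  | nil =>
    simp only [leibnizSum, norm_mul]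
    gcongr
    exact hC _
  | cons i l ih =>
    exact (norm_add_le _ _).trans (add_le_add (ih _ _ fun a => hC _) (ih _ _ hC))

/-- The pointwise product of Schwartz functions. -/
def schMul (f g : 𝓢(EuclideanSpace ℝ (Fin N), ℂ)) : 𝓢(EuclideanSpace ℝ (Fin N), ℂ) :=
  SchwartzMap.pairing (ContinuousLinearMap.mul ℂ ℂ) f g

theorem schMul_apply (f g : 𝓢(EuclideanSpace ℝ (Fin N), ℂ)) (x : EuclideanSpace ℝ (Fin N)) :
    schMul f g x = f x * g x := by
  rw [schMul, SchwartzMap.pairing_apply_apply]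
  rfl

theorem coordDeriv_schMul (i : Fin N) (f g : 𝓢(EuclideanSpace ℝ (Fin N), ℂ)) :
    coordDeriv i (schMul f g) = schMul (coordDeriv i f) g + schMul f (coordDeriv i g) := by
  ext x
  have h : ⇑(schMul f g) = ⇑f * ⇑g := funext (schMul_apply f g)
  rw [add_apply, schMul_apply, schMul_apply, SchwartzMap.lineDerivOp_apply_eq_fderiv, h,
    SchwartzMap.lineDerivOp_apply_eq_fderiv, SchwartzMap.lineDerivOp_apply_eq_fderiv,
    ((f.hasFDerivAt x).mul (g.hasFDerivAt x)).fderiv]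
  simp
  ring

theorem schPartial_cons' (i : Fin N) (l : List (Fin N)) (f : 𝓢(EuclideanSpace ℝ (Fin N), ℂ)) :
    schPartial (i :: l) f = schPartial l (coordDeriv i f) := by
  induction l with
  | nil => rfl
  | cons j l ih => rw [schPartial_cons, schPartial_cons, coordDeriv_comm, ← schPartial_cons i, ih,
      schPartial_cons]

theorem schPartial_add (l : List (Fin N)) (f g : 𝓢(EuclideanSpace ℝ (Fin N), ℂ)) :
    schPartial l (f + g) = schPartial l f + schPartial l g := by
  induction l with
  | nil => rfl
  | cons i l ih => rw [schPartial_cons, ih, coordDeriv, LineDerivAdd.lineDerivOp_add]; rfl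

theorem schPartial_schMul (l : List (Fin N)) (f g : 𝓢(EuclideanSpace ℝ (Fin N), ℂ))
    (x : EuclideanSpace ℝ (Fin N)) :
    schPartial l (schMul f g) x =
      leibnizSum l (fun a => schPartial a f x) fun b => schPartial b g x := by
  induction l generalizing f g with
  | nil => exact schMul_apply f g x
  | cons i l ih =>
    rw [schPartial_cons', coordDeriv_schMul, schPartial_add, add_apply, ih, ih, leibnizSum]
    simp only [schPartial_cons']

theorem IsTest.schMul {f g : 𝓢(EuclideanSpace ℝ (Fin N), ℂ)} (hf : IsTest f) :
    IsTest (schMul f g) := by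
  have h : tsupport (_root_.schMul f g) ⊆ tsupport f := closure_mono fun x hx => by
    contrapose! hx
    simp only [Function.mem_support, not_not] at hx
    simp [schMul_apply, hx]
  exact ⟨hf.1.of_isClosed_subset (isClosed_tsupport _) h, fun h0 => hf.2 (h h0)⟩

/-! ### Cutoff functions -/

/-- The dilation `x ↦ f (c x)` of a Schwartz function. -/
def schDilate (c : ℝˣ) (f : 𝓢(EuclideanSpace ℝ (Fin N), ℂ)) : 𝓢(EuclideanSpace ℝ (Fin N), ℂ) :=
  SchwartzMap.compCLMOfContinuousLinearEquiv ℂ (ContinuousLinearEquiv.smulLeft c) f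

theorem schDilate_apply (c : ℝˣ) (f : 𝓢(EuclideanSpace ℝ (Fin N), ℂ))
    (x : EuclideanSpace ℝ (Fin N)) : schDilate c f x = f ((c : ℝ) • x) := rfl

theorem schPartial_schDilate (c : ℝˣ) (l : List (Fin N)) (f : 𝓢(EuclideanSpace ℝ (Fin N), ℂ)) :
    schPartial l (schDilate c f) = (c : ℝ) ^ l.length • schDilate c (schPartial l f) := by
  have h : ∀ (i : Fin N) g, coordDeriv i (schDilate c g) = (c : ℝ) • schDilate c (coordDeriv i g) := by
    intro i g
    ext x
    rw [coordDeriv, schDilate, SchwartzMap.lineDerivOp_compCLMOfContinuousLinearEquiv]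
    change (∂_{(c : ℝ) • EuclideanSpace.single i (1 : ℝ)} g) ((c : ℝ) • x) = _
    rw [LineDerivLeftSMul.lineDerivOp_left_smul]
    rfl
  induction l with
  | nil => simp
  | cons i l ih =>
    rw [schPartial_cons, ih, coordDeriv, LineDerivSMul.lineDerivOp_smul]
    have := h i (schPartial l f)
    rw [coordDeriv] at this
    rw [this, smul_smul, List.length_cons, pow_succ]
    rfl

theorem schPartial_sub (l : List (Fin N)) (f g : 𝓢(EuclideanSpace ℝ (Fin N), ℂ)) :
    schPartial l (f - g) = schPartial l f - schPartial l g := by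
  rw [eq_sub_iff_add_eq, ← schPartial_add, sub_add_cancel]

theorem schPartial_of_eqOn_const {f : 𝓢(EuclideanSpace ℝ (Fin N), ℂ)}
    {U : Set (EuclideanSpace ℝ (Fin N))} (hU : IsOpen U) {c : ℂ} (hf : ∀ x ∈ U, f x = c)
    (l : List (Fin N)) : ∀ x ∈ U, schPartial l f x = if l = [] then c else 0 := by
  induction l with
  | nil => simpa using hf
  | cons i l ih =>
    intro x hx
    rw [schPartial_cons, SchwartzMap.lineDerivOp_apply_eq_fderiv]
    have h : ⇑(schPartial l f) =ᶠ[nhds x] fun _ => if l = [] then c else 0 := by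
      filter_upwards [hU.mem_nhds hx] with y hy using ih y hy
    rw [h.fderiv_eq]
    simp

theorem norm_pow_mul_schPartial_schDilate_le (l : List (Fin N))
    (f : 𝓢(EuclideanSpace ℝ (Fin N), ℂ)) :
    ∃ C, ∀ (c : ℝˣ) x, ‖x‖ ^ l.length * ‖schPartial l (schDilate c f) x‖ ≤ C := by
  obtain ⟨C, -, hC⟩ := (schPartial l f).decay l.length 0
  refine ⟨C, fun c x => ?_⟩
  have h := hC ((c : ℝ) • x)
  rw [norm_iteratedFDeriv_zero, norm_smul, mul_pow] at h
  rw [schPartial_schDilate, smul_apply, schDilate_apply, norm_smul, norm_pow]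
  linarith

/-- Smooth cutoffs which converge to `1` off the origin, with scale invariant bounds:
`|x|^{|a|} D_a χ_n` is bounded uniformly in `n`. -/
theorem exists_cutoff : ∃ χ : ℕ → 𝓢(EuclideanSpace ℝ (Fin N), ℂ), (∀ n, IsTest (χ n)) ∧
    (∀ a : List (Fin N), ∃ C, ∀ n x, ‖x‖ ^ a.length * ‖schPartial a (χ n) x‖ ≤ C) ∧
    ∀ (a : List (Fin N)) (x : EuclideanSpace ℝ (Fin N)), x ≠ 0 →
      ∀ᶠ n in Filter.atTop, schPartial a (χ n) x = if a = [] then 1 else 0 := by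
  let b : ContDiffBump (0 : EuclideanSpace ℝ (Fin N)) := ⟨1, 2, one_pos, one_lt_two⟩
  have hb : HasCompactSupport fun x => (b x : ℂ) := b.hasCompactSupport.comp_left Complex.ofReal_zero
  let F := hb.toSchwartzMap (Complex.ofRealCLM.contDiff.comp b.contDiff)
  have hF : ∀ x, F x = (b x : ℂ) := fun x => rfl
  have hF1 : ∀ x, ‖x‖ < 1 → F x = 1 := fun x hx => by
    rw [hF, b.one_of_mem_closedBall (by simpa [b] using hx.le), Complex.ofReal_one]
  have hF2 : ∀ x, 2 < ‖x‖ → F x = 0 := fun x hx => by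
    rw [hF, b.zero_of_le_dist (by simpa [b] using hx.le), Complex.ofReal_zero]
  have hD1 : ∀ (a : List (Fin N)) x, ‖x‖ < 1 → schPartial a F x = if a = [] then 1 else 0 := fun a =>
    schPartial_of_eqOn_const (isOpen_lt continuous_norm continuous_const) hF1 a
  have hD2 : ∀ (a : List (Fin N)) x, 2 < ‖x‖ → schPartial a F x = 0 := fun a x hx => by
    rw [schPartial_of_eqOn_const (isOpen_lt continuous_const continuous_norm) hF2 a x hx, ite_self]
  let u : ℕ → ℝˣ := fun n => Units.mk0 ((n : ℝ) + 1) (by positivity)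
  have hu : ∀ n, ((u n : ℝˣ) : ℝ) = n + 1 := fun n => rfl
  have hui : ∀ n, ((u n)⁻¹ : ℝˣ) = ((n : ℝ) + 1)⁻¹ := fun n => by simp [u]
  have hns : ∀ n (x : EuclideanSpace ℝ (Fin N)), ‖(u n : ℝ) • x‖ = (n + 1) * ‖x‖ := fun n x => by
    rw [norm_smul, hu, Real.norm_of_nonneg (by positivity)]
  have hnsi : ∀ n (x : EuclideanSpace ℝ (Fin N)), ‖(((u n)⁻¹ : ℝˣ) : ℝ) • x‖ = ‖x‖ / (n + 1) :=
    fun n x => by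
      rw [norm_smul, hui, Real.norm_of_nonneg (by positivity), inv_mul_eq_div]
  have happ : ∀ n x, (schDilate (u n)⁻¹ F - schDilate (u n) F) x =
      F ((((u n)⁻¹ : ℝˣ) : ℝ) • x) - F ((u n : ℝ) • x) := fun n x => rfl
  refine ⟨fun n => schDilate (u n)⁻¹ F - schDilate (u n) F, fun n => ⟨?_, ?_⟩, fun a => ?_,
    fun a x hx => ?_⟩
  · refine HasCompactSupport.intro (isCompact_closedBall 0 (2 * ((n : ℝ) + 1))) fun x hx => ?_
    rw [mem_closedBall_zero_iff, not_le] at hx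
    have hn : (1 : ℝ) ≤ n + 1 := by linarith [n.cast_nonneg (α := ℝ)]
    rw [happ, hF2, hF2, sub_zero]
    · rw [hns]; nlinarith [norm_nonneg x]
    · rw [hnsi, lt_div_iff₀ (by positivity)]; exact hx
  · rw [notMem_tsupport_iff_eventuallyEq]
    have hn : (1 : ℝ) ≤ n + 1 := by linarith [n.cast_nonneg (α := ℝ)]
    filter_upwards [Metric.ball_mem_nhds (0 : EuclideanSpace ℝ (Fin N))
      (ε := 1 / ((n : ℝ) + 1)) (by positivity)] with x hx
    rw [mem_ball_zero_iff, lt_div_iff₀ (by positivity)] at hx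
    rw [happ, hF1, hF1, sub_self]
    · rfl
    · rw [hns]; linarith
    · rw [hnsi, div_lt_iff₀ (by positivity)]; nlinarith [norm_nonneg x]
  · obtain ⟨C, hC⟩ := norm_pow_mul_schPartial_schDilate_le a F
    refine ⟨C + C, fun n x => ?_⟩
    rw [schPartial_sub, sub_apply]
    calc _ ≤ ‖x‖ ^ a.length * (‖schPartial a (schDilate (u n)⁻¹ F) x‖ +
          ‖schPartial a (schDilate (u n) F) x‖) := by gcongr; exact norm_sub_le _ _
      _ ≤ _ := by rw [mul_add]; exact add_le_add (hC _ x) (hC _ x)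
  · have hx' : 0 < ‖x‖ := norm_pos_iff.2 hx
    obtain ⟨n₀, hn₀⟩ := exists_nat_gt (max ‖x‖ (2 / ‖x‖))
    filter_upwards [Filter.eventually_ge_atTop n₀] with n hn
    have hn' : (n₀ : ℝ) ≤ n := by exact_mod_cast hn
    have h1 : ‖x‖ < n := (le_max_left _ _).trans_lt (hn₀.trans_le hn')
    have h2 : 2 < n * ‖x‖ := by
      rw [← div_lt_iff₀ hx']; exact (le_max_right _ _).trans_lt (hn₀.trans_le hn')
    rw [schPartial_sub, sub_apply, schPartial_schDilate, schPartial_schDilate,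
      smul_apply, smul_apply, schDilate_apply, schDilate_apply, hD1, hD2,
      smul_zero, sub_zero]
    · split_ifs with h <;> simp [h]
    · rw [hns]; linarith
    · rw [hnsi, div_lt_iff₀ (by positivity)]; linarith

/-! ### Approximation by test functions -/

theorem leibnizSum_congr {ι R : Type*} [Add R] [Mul R] (l : List ι) {c c' z z' : List ι → R}
    (h : ∀ a b, a.length + b.length = l.length → c a * z b = c' a * z' b) :
    leibnizSum l c z = leibnizSum l c' z' := by
  induction l generalizing c c' z z' with
  | nil => exact h [] [] rfl
  | cons i l ih =>
    simp only [leibnizSum]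
    congr 1
    · refine ih fun a b hab => h _ _ ?_
      simp only [List.length_cons]; omega
    · refine ih fun a b hab => h _ _ ?_
      simp only [List.length_cons]; omega

theorem leibnizSum_mul_left {ι R : Type*} [CommRing R] (l : List ι) (r : R) (c z : List ι → R) :
    leibnizSum l (fun a => r * c a) z = r * leibnizSum l c z := by
  induction l generalizing c z with
  | nil => simp [leibnizSum, mul_assoc]
  | cons i l ih => simp only [leibnizSum, ih, mul_add]

/-- Dominated convergence in `L²`, for functions which are eventually zero at almost every point. -/
theorem tendsto_eLpNorm_of_eventually_eq_zero {X : Type*} [MeasurableSpace X] {μ : Measure X}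
    {G : ℕ → X → ℂ} {g : X → ℝ} (hG : ∀ n, AEStronglyMeasurable (G n) μ) (hg : MemLp g 2 μ)
    (hle : ∀ n, ∀ᵐ x ∂μ, ‖G n x‖ ≤ g x)
    (h0 : ∀ᵐ x ∂μ, ∀ᶠ n in Filter.atTop, G n x = 0) :
    Filter.Tendsto (fun n => eLpNorm (G n) 2 μ) Filter.atTop (nhds 0) := by
  have h : Filter.Tendsto (fun n => ∫⁻ x, ‖G n x‖ₑ ^ (2 : ℝ) ∂μ) Filter.atTop
      (nhds (∫⁻ _, 0 ∂μ)) := by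
    refine tendsto_lintegral_of_dominated_convergence' (fun x => ‖g x‖ₑ ^ (2 : ℝ))
      (fun n => (hG n).enorm.pow_const _) (fun n => ?_) ?_ ?_
    · filter_upwards [hle n] with x hx
      gcongr
      rw [enorm_le_iff_norm_le]
      exact hx.trans (le_abs_self _)
    · have := (eLpNorm_lt_top_iff_lintegral_rpow_enorm_lt_top (by simp) (by simp)).1 hg.2
      simpa using this.ne
    · filter_upwards [h0] with x hx
      refine tendsto_const_nhds.congr' ?_
      filter_upwards [hx] with n hn
      simp [hn]
  rw [lintegral_zero] at h
  have h' := h.ennrpow_const (1 / 2)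
  simp only [one_div, ENNReal.zero_rpow_of_pos (show (0 : ℝ) < 2⁻¹ by norm_num)] at h'
  refine h'.congr fun n => ?_
  rw [eLpNorm_eq_lintegral_rpow_enorm_toReal (by simp) (by simp)]
  simp

theorem aestronglyMeasurable_norm_rpow (s : ℝ) :
    AEStronglyMeasurable (fun x : EuclideanSpace ℝ (Fin N) => ‖x‖ ^ s) volume :=
  (measurable_norm.pow_const s).aestronglyMeasurable

theorem aestronglyMeasurable_leibnizSum {l : List (Fin N)}
    {c z : List (Fin N) → EuclideanSpace ℝ (Fin N) → ℂ}
    (hc : ∀ a, AEStronglyMeasurable (c a) volume) (hz : ∀ a, AEStronglyMeasurable (z a) volume) :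
    AEStronglyMeasurable (fun x => leibnizSum l (fun a => c a x) fun b => z b x) volume := by
  have := leibnizSum_induction (P := fun f => AEStronglyMeasurable f volume)
    (fun f g hf hg => hf.add hg) l c z fun a b _ => (hc a).mul (hz b)
  refine this.congr (.of_forall fun x => leibnizSum_apply l c z x)

/-- Truncating `u` by cutoffs with scale invariant bounds converges in weighted norms, because the
terms in which derivatives fall on the cutoff are dominated by `|x|^{s-|a|} |D_b u|`,
`|a| + |b| = |l|`. -/
theorem tendsto_eLpNorm_cutoff (hN : 0 < N) {χ : ℕ → 𝓢(EuclideanSpace ℝ (Fin N), ℂ)}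
    (hb : ∀ a : List (Fin N), ∃ C, ∀ n x, ‖x‖ ^ a.length * ‖schPartial a (χ n) x‖ ≤ C)
    (h1 : ∀ (a : List (Fin N)) (x : EuclideanSpace ℝ (Fin N)), x ≠ 0 →
      ∀ᶠ n in Filter.atTop, schPartial a (χ n) x = if a = [] then 1 else 0)
    {u : LTwo N} {s : ℝ} {l : List (Fin N)}
    (hfin : ∀ b : List (Fin N), b.length ≤ l.length →
      weightedNorm (s - l.length + b.length) b u < ⊤) :
    Filter.Tendsto (fun n => eLpNorm (fun x => ‖x‖ ^ s • (weakPartial l u x -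
      leibnizSum l (fun a => schPartial a (χ n) x) fun b => weakPartial b u x)) 2 volume)
      Filter.atTop (nhds 0) := by
  choose C hC using hb
  have hW : ∀ b : List (Fin N), b.length ≤ l.length →
      MemLp (fun x => ‖x‖ ^ (s - l.length + b.length) • weakPartial b u x) 2 volume := fun b hb =>
    ⟨(aestronglyMeasurable_norm_rpow _).smul (Lp.aestronglyMeasurable _), hfin b hb⟩
  have hsum : MemLp (fun x => leibnizSum l (fun a => C a * ‖x‖ ^ (s - a.length))
      fun b => ‖weakPartial b u x‖) 2 volume := by
    have := leibnizSum_induction (P := fun f => MemLp f 2 volume) (fun f g hf hg => hf.add hg) l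
      (fun a x => C a * ‖x‖ ^ (s - a.length)) (fun b x => ‖weakPartial b u x‖) fun a b hab => by
        refine ((hW b (by omega)).norm.const_mul (C a)).congr_norm ?_ (.of_forall fun x => ?_)
        · exact ((aestronglyMeasurable_norm_rpow _).const_mul _).mul (Lp.aestronglyMeasurable _).norm
        · have e : s - l.length + b.length = s - a.length := by rw [← hab]; push_cast; ring
          rw [e]
          simp [mul_assoc]
    exact (memLp_congr_ae (.of_forall fun x => leibnizSum_apply l _ _ x)).1 this
  have hl := (hW l le_rfl).norm
  rw [show s - l.length + l.length = s by ring] at hl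
  refine tendsto_eLpNorm_of_eventually_eq_zero (fun n => ?_) (hl.add hsum) (fun n => ?_) ?_
  · exact (aestronglyMeasurable_norm_rpow s).smul ((Lp.aestronglyMeasurable _).sub
      (aestronglyMeasurable_leibnizSum (fun a => by fun_prop) fun b => Lp.aestronglyMeasurable _))
  · filter_upwards [ae_ne_zero hN] with x hx
    have hx' : 0 < ‖x‖ := norm_pos_iff.2 hx
    rw [smul_sub]
    refine (norm_sub_le _ _).trans (add_le_add le_rfl ?_)
    rw [Complex.real_smul, ← leibnizSum_mul_left]
    refine norm_leibnizSum_le _ _ _ fun a => ?_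
    rw [norm_mul, Complex.norm_real, Real.norm_of_nonneg (by positivity),
      Real.rpow_sub hx', Real.rpow_natCast]
    have := hC a n x
    calc _ = ‖x‖ ^ s / ‖x‖ ^ a.length * (‖x‖ ^ a.length * ‖schPartial a (χ n) x‖) := by
          field_simp
      _ ≤ ‖x‖ ^ s / ‖x‖ ^ a.length * C a := by gcongr
      _ = _ := mul_comm _ _
  · filter_upwards [ae_ne_zero hN] with x hx
    have h := (Filter.eventually_all_finite (List.finite_length_le (Fin N) l.length)).2
      fun a _ => h1 a x hx
    filter_upwards [h] with n hn
    rw [leibnizSum_of_eq_ite l _ _ hn, sub_self, smul_zero]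

/-- After multiplication by a fixed test function, convergence in `H⁴` implies convergence in all
weighted norms. -/
theorem tendsto_eLpNorm_leibnizSum {χ : 𝓢(EuclideanSpace ℝ (Fin N), ℂ)} (hχ : IsTest χ)
    {l : List (Fin N)} {v : ℕ → LTwo N}
    (hv : ∀ b : List (Fin N), b.length ≤ l.length →
      Filter.Tendsto (fun j => ‖weakPartial b (v j)‖) Filter.atTop (nhds 0)) (s : ℝ) :
    Filter.Tendsto (fun j => eLpNorm (fun x => ‖x‖ ^ s •
      leibnizSum l (fun a => schPartial a χ x) fun b => weakPartial b (v j) x) 2 volume)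
      Filter.atTop (nhds 0) := by
  have key := leibnizSum_induction (R := ℕ → EuclideanSpace ℝ (Fin N) → ℂ) (P := fun G =>
      (∀ j, AEStronglyMeasurable (G j) volume) ∧
        Filter.Tendsto (fun j => eLpNorm (G j) 2 volume) Filter.atTop (nhds 0)) ?_ l
    (fun a _ x => ((‖x‖ ^ s : ℝ) : ℂ) * schPartial a χ x) (fun b j x => weakPartial b (v j) x) ?_
  · refine key.2.congr fun j => ?_
    congr 1
    funext x
    rw [leibnizSum_apply, leibnizSum_apply, leibnizSum_mul_left, Complex.real_smul]
  · intro f g hf hg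
    refine ⟨fun j => (hf.1 j).add (hg.1 j), ?_⟩
    have h := hf.2.add hg.2
    rw [add_zero] at h
    exact tendsto_of_tendsto_of_tendsto_of_le_of_le tendsto_const_nhds h (fun _ => zero_le)
      fun j => eLpNorm_add_le (hf.1 j) (hg.1 j) (by norm_num)
  · intro a b hab
    have hc := (hχ.schPartial a).continuous_rpow_smul s
    obtain ⟨M, hM⟩ := ((hχ.schPartial a).hasCompactSupport_rpow_smul s).exists_bound_of_continuous hc
    simp only [Complex.real_smul] at hc hM
    refine ⟨fun j => hc.aestronglyMeasurable.mul (Lp.aestronglyMeasurable _), ?_⟩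
    have h := ENNReal.tendsto_ofReal ((hv b (by omega)).const_mul M)
    rw [mul_zero, ENNReal.ofReal_zero] at h
    refine tendsto_of_tendsto_of_tendsto_of_le_of_le tendsto_const_nhds h (fun _ => zero_le)
      fun j => ?_
    have hM0 : 0 ≤ M := (norm_nonneg _).trans (hM 0)
    refine (eLpNorm_le_mul_eLpNorm_of_ae_le_mul (g := weakPartial b (v j)) (c := M)
      (.of_forall fun x => ?_) 2).trans ?_
    · rw [Pi.mul_apply, Pi.mul_apply]
      rw [norm_mul]
      gcongr
      exact hM x
    · rw [← Lp.enorm_def, ← ofReal_norm, ← ENNReal.ofReal_mul hM0]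

theorem weakPartial_sub_toLp_ae {u : LTwo N} (hu : MemSobolev 4 2 u.toDistr)
    {b : List (Fin N)} (hb : b.length ≤ 4) (g : 𝓢(EuclideanSpace ℝ (Fin N), ℂ)) :
    ∀ᵐ x, weakPartial b (u - g.toLp 2 volume) x = weakPartial b u x - schPartial b g x := by
  rw [weakPartial_sub hb hu (memSobolev_toLp g 4), weakPartial_toLp]
  filter_upwards [Lp.coeFn_sub (weakPartial b u) ((schPartial b g).toLp 2 volume),
    (schPartial b g).coeFn_toLp 2 volume] with x hx1 hx2
  rw [hx1, Pi.sub_apply, hx2]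

/-- The error of approximating `u` by `χ ψ` is the error of truncating `u` by `χ`, plus a multiple
of the error of approximating `u` by `ψ`. -/
theorem weakPartial_sub_schMul_ae {u : LTwo N} (hu : MemSobolev 4 2 u.toDistr)
    {l : List (Fin N)} (hl : l.length ≤ 4) (χ ψ : 𝓢(EuclideanSpace ℝ (Fin N), ℂ)) :
    ∀ᵐ x, weakPartial l (u - (schMul χ ψ).toLp 2 volume) x = (weakPartial l u x -
        leibnizSum l (fun a => schPartial a χ x) fun b => weakPartial b u x) +
      leibnizSum l (fun a => schPartial a χ x)
        fun b => weakPartial b (u - ψ.toLp 2 volume) x := by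
  have hall : ∀ᵐ x, ∀ b : List (Fin N), b.length ≤ 4 →
      weakPartial b (u - ψ.toLp 2 volume) x = weakPartial b u x - schPartial b ψ x := by
    rw [ae_all_iff]
    intro b
    by_cases hb : b.length ≤ 4
    · filter_upwards [weakPartial_sub_toLp_ae hu hb ψ] with x hx _ using hx
    · exact .of_forall fun x h => absurd h hb
  filter_upwards [hall, weakPartial_sub_toLp_ae hu hl (schMul χ ψ)] with x hx1 hx2
  have h := leibnizSum_congr l (c := fun a => schPartial a χ x) (c' := fun a => schPartial a χ x)
    (z := fun b => weakPartial b (u - ψ.toLp 2 volume) x)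
    (z' := fun b => weakPartial b u x - schPartial b ψ x)
    fun a b hab => by rw [hx1 b (by omega)]
  rw [hx2, schPartial_schMul, h, leibnizSum_sub, sub_add_sub_cancel]

/-- Functions in `H⁴` with finite weighted norms are approximated by test functions, in these
norms. -/
theorem exists_test_weightedNorm_sub_lt (hN : 0 < N) {u : LTwo N} (hu : MemSobolev 4 2 u.toDistr)
    {W : Set (ℝ × List (Fin N))} (hW : W.Finite) (hl : ∀ p ∈ W, p.2.length ≤ 4)
    (hfin : ∀ p ∈ W, ∀ b : List (Fin N), b.length ≤ p.2.length →
      weightedNorm (p.1 - p.2.length + b.length) b u < ⊤) {ε : ℝ≥0∞} (hε : 0 < ε) :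
    ∃ f : 𝓢(EuclideanSpace ℝ (Fin N), ℂ), IsTest f ∧
      ∀ p ∈ W, weightedNorm p.1 p.2 (u - f.toLp 2 volume) < ε := by
  obtain ⟨χ, hχ, hb, h1⟩ := exists_cutoff (N := N)
  have hε2 : 0 < ε / 2 := ENNReal.half_pos hε.ne'
  obtain ⟨n, hn⟩ := ((Filter.eventually_all_finite hW).2 fun p hp =>
    (tendsto_eLpNorm_cutoff hN hb h1 (hfin p hp)).eventually (gt_mem_nhds hε2)).exists
  choose ψ hψ using fun j : ℕ => exists_schwartz_weakPartial_sub_lt hu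
    (ε := 1 / ((j : ℝ) + 1)) (by positivity)
  have hv : ∀ b : List (Fin N), b.length ≤ 4 →
      Filter.Tendsto (fun j => ‖weakPartial b (u - (ψ j).toLp 2 volume)‖) Filter.atTop (nhds 0) :=
    fun b hb => squeeze_zero (fun _ => norm_nonneg _) (fun j => (hψ j b hb).le)
      tendsto_one_div_add_atTop_nhds_zero_nat
  obtain ⟨j, hj⟩ := ((Filter.eventually_all_finite hW).2 fun p hp =>
    (tendsto_eLpNorm_leibnizSum (hχ n) (fun b hb => hv b (hb.trans (hl p hp))) p.1).eventually
      (gt_mem_nhds hε2)).exists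
  refine ⟨schMul (χ n) (ψ j), (hχ n).schMul, fun p hp => ?_⟩
  obtain ⟨s, l⟩ := p
  have hae : (fun x => ‖x‖ ^ s • weakPartial l (u - (schMul (χ n) (ψ j)).toLp 2 volume) x)
      =ᵐ[volume] (fun x => ‖x‖ ^ s • (weakPartial l u x -
        leibnizSum l (fun a => schPartial a (χ n) x) fun b => weakPartial b u x)) +
      fun x => ‖x‖ ^ s • leibnizSum l (fun a => schPartial a (χ n) x)
        fun b => weakPartial b (u - (ψ j).toLp 2 volume) x := by
    filter_upwards [weakPartial_sub_schMul_ae hu (hl _ hp) (χ n) (ψ j)] with x hx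
    rw [Pi.add_apply, hx, smul_add]
  have hm : ∀ z : List (Fin N) → LTwo N, AEStronglyMeasurable (fun x =>
      leibnizSum l (fun a => schPartial a (χ n) x) fun b => z b x) volume := fun z =>
    aestronglyMeasurable_leibnizSum (fun a => by fun_prop) fun b => Lp.aestronglyMeasurable _
  have h := eLpNorm_add_le ((aestronglyMeasurable_norm_rpow s).smul
    ((Lp.aestronglyMeasurable (weakPartial l u)).sub (hm fun b => weakPartial b u)))
    ((aestronglyMeasurable_norm_rpow s).smul
      (hm fun b => weakPartial b (u - (ψ j).toLp 2 volume))) one_le_two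
  have h' := ENNReal.add_lt_add (hn (s, l) hp) (hj (s, l) hp)
  rw [ENNReal.add_halves] at h'
  exact (eLpNorm_congr_ae hae).trans_lt (h.trans_lt h')

/-! ### The graph norm and the weighted norms -/

/-- The pairs `(s, l)` for which `‖|x|^s D_l u‖₂` enters the norm of the domain of the operator:
`|x|^{2α-h} D^{4-h} u`, the unweighted `D⁴ u` and `u`, and `|x|^{2β} u`. -/
def graphIndex (N : ℕ) (α β : ℝ) : Set (ℝ × List (Fin N)) :=
  {p | p.2.length ≤ 4 ∧ (p.1 = 2 * α - (4 - p.2.length) ∨ (p.1 = 0 ∧ p.2.length = 4) ∨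
    ((p.1 = 2 * β ∨ p.1 = 0) ∧ p.2 = []))}

theorem finite_graphIndex (N : ℕ) (α β : ℝ) : (graphIndex N α β).Finite := by
  have hL := List.finite_length_le (Fin N) 4
  refine (((hL.image fun l => (2 * α - (4 - (l.length : ℝ)), l)).union
    (hL.image fun l => ((0 : ℝ), l))).union (hL.image fun l => (2 * β, l))).subset ?_
  rintro ⟨s, l⟩ ⟨hl, h | ⟨h, -⟩ | ⟨h | h, -⟩⟩
  · exact Or.inl (Or.inl ⟨l, hl, Prod.ext h.symm rfl⟩)
  · exact Or.inl (Or.inr ⟨l, hl, by rw [← h]⟩)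
  · exact Or.inr ⟨l, hl, by rw [← h]⟩
  · exact Or.inl (Or.inr ⟨l, hl, by rw [← h]⟩)

theorem lTwoRepr_bilaplacian {u : LTwo N} (hu : MemSobolev 4 2 u.toDistr) :
    lTwoRepr (Δ (Δ u.toDistr)) = ∑ i, ∑ j, weakPartial [i, i, j, j] u := by
  apply LTwo.toDistr_injective
  have hsum : ∀ w : Fin N → LTwo N, (∑ i, w i).toDistr = ∑ i, (w i).toDistr := fun w =>
    map_sum (Lp.toTemperedDistributionCLM ℂ volume 2) w Finset.univ
  have hlap : ∀ T : 𝓢'(EuclideanSpace ℝ (Fin N), ℂ), Δ T =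
      ∑ i, ∂_{EuclideanSpace.single i (1 : ℝ)} (∂_{EuclideanSpace.single i (1 : ℝ)} T) := fun T => by
    simpa using TemperedDistribution.laplacian_eq_sum (EuclideanSpace.basisFun (Fin N) ℝ) T
  rw [bilaplacian_repr hu, hsum, hlap]
  congr with i : 1
  rw [hsum, hlap, LineDeriv.lineDerivOp_sum, LineDeriv.lineDerivOp_sum]
  congr with j : 1
  rw [toDistr_weakPartial (by simp) hu]
  rfl

theorem lTwoRepr_bilaplacian_toLp (f : 𝓢(EuclideanSpace ℝ (Fin N), ℂ)) :
    lTwoRepr (Δ (Δ (LTwo.toDistr (f.toLp 2)))) = (Δ (Δ f)).toLp 2 := by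
  rw [toDistr_toLp, laplacian_toTemperedDistributionCLM_eq,
    laplacian_toTemperedDistributionCLM_eq, ← toDistr_toLp, lTwoRepr_toDistr]

theorem norm_rpow_sq (x : EuclideanSpace ℝ (Fin N)) (s : ℝ) : (‖x‖ ^ s) ^ 2 = ‖x‖ ^ (2 * s) := by
  rw [← Real.rpow_mul_natCast (norm_nonneg x), mul_comm, Nat.cast_ofNat]

theorem eLpNorm_potentialSq (β : ℝ) (u : LTwo N) :
    eLpNorm (potentialSq β u) 2 volume = weightedNorm (2 * β) [] u := by
  rw [weightedNorm, weakPartial_nil]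
  congr 1
  funext x
  rw [potentialSq, potential, norm_rpow_sq]

theorem weightedNorm_zero (l : List (Fin N)) (u : LTwo N) :
    weightedNorm 0 l u = eLpNorm (weakPartial l u) 2 volume := by
  simp [weightedNorm]

theorem aestronglyMeasurable_potentialSq (β : ℝ) (u : LTwo N) :
    AEStronglyMeasurable (potentialSq β u) volume :=
  (((measurable_norm.pow_const β).pow_const 2).aestronglyMeasurable).smul
    (Lp.aestronglyMeasurable u)

theorem aestronglyMeasurable_diffusion_smul (α : ℝ) (u : LTwo N) :
    AEStronglyMeasurable (fun x => (diffusion α x ^ 2 : ℝ) • u x) volume := by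
  have h : Measurable fun x : EuclideanSpace ℝ (Fin N) => diffusion α x ^ 2 :=
    ((measurable_norm.pow_const α).const_add 1).pow_const 2
  exact h.aestronglyMeasurable.smul (Lp.aestronglyMeasurable u)

theorem aestronglyMeasurable_opA (α β : ℝ) (u : LTwo N) :
    AEStronglyMeasurable (opA α β u) volume :=
  (aestronglyMeasurable_diffusion_smul α _).add (aestronglyMeasurable_potentialSq β u)

theorem eLpNorm_diffusion_smul_le (α : ℝ) (l : List (Fin N)) (u : LTwo N) {K : ℝ≥0∞}
    (h0 : weightedNorm 0 l u ≤ K) (h1 : weightedNorm (2 * α) l u ≤ K) :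
    eLpNorm (fun x => (diffusion α x ^ 2 : ℝ) • weakPartial l u x) 2 volume ≤ 4 * K := by
  have hm : AEStronglyMeasurable (fun x => ‖x‖ ^ (2 * α) • weakPartial l u x) volume :=
    (aestronglyMeasurable_norm_rpow _).smul (Lp.aestronglyMeasurable _)
  have hU : AEStronglyMeasurable (weakPartial l u) volume := Lp.aestronglyMeasurable _
  calc _ ≤ ENNReal.ofReal 2 * eLpNorm (fun x => ‖weakPartial l u x‖ +
        ‖‖x‖ ^ (2 * α) • weakPartial l u x‖) 2 volume := by
        refine eLpNorm_le_mul_eLpNorm_of_ae_le_mul (.of_forall fun x => ?_) 2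
        have hx : 0 ≤ ‖x‖ ^ α := by positivity
        rw [norm_smul, norm_smul, ← norm_rpow_sq, Real.norm_of_nonneg (sq_nonneg _),
          Real.norm_of_nonneg (sq_nonneg _), Real.norm_of_nonneg (by positivity), diffusion]
        nlinarith [norm_nonneg (weakPartial l u x),
          mul_nonneg (sq_nonneg (1 - ‖x‖ ^ α)) (norm_nonneg (weakPartial l u x))]
    _ ≤ ENNReal.ofReal 2 * (K + K) := by
        gcongr
        refine (eLpNorm_add_le hU.norm hm.norm one_le_two).trans ?_
        rw [eLpNorm_norm, eLpNorm_norm, ← weightedNorm_zero]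
        exact add_le_add h0 h1
    _ = 4 * K := by rw [← two_mul, ← mul_assoc]; norm_num

/-- The graph norm is dominated by the weighted norms. -/
theorem graphNorm_le {α β : ℝ} {u : LTwo N} (hu : MemSobolev 4 2 u.toDistr) {K : ℝ≥0∞}
    (hK : ∀ p ∈ graphIndex N α β, weightedNorm p.1 p.2 u ≤ K) :
    graphNorm α β u ≤ (4 * N ^ 2 + 2) * K := by
  have hae : opA α β u =ᵐ[volume] (∑ i, ∑ j, fun x =>
      (diffusion α x ^ 2 : ℝ) • weakPartial [i, i, j, j] u x) + potentialSq β u := by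
    have h : ∀ᵐ x, (∑ i : Fin N, ∑ j : Fin N, weakPartial [i, i, j, j] u : LTwo N) x =
        ∑ i : Fin N, ∑ j : Fin N, weakPartial [i, i, j, j] u x := by
      have h1 : ∀ᵐ x, ∀ i : Fin N, (∑ j : Fin N, weakPartial [i, i, j, j] u : LTwo N) x =
          ∑ j : Fin N, weakPartial [i, i, j, j] u x := by
        rw [ae_all_iff]
        intro i
        filter_upwards [Lp.coeFn_finsetSum Finset.univ fun j => weakPartial [i, i, j, j] u] with x hx
        rw [hx, Finset.sum_apply]
      filter_upwards [h1, Lp.coeFn_finsetSum Finset.univ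
        fun i : Fin N => ∑ j : Fin N, weakPartial [i, i, j, j] u] with x hx hx'
      rw [hx', Finset.sum_apply]
      exact Finset.sum_congr rfl fun i _ => hx i
    filter_upwards [h] with x hx
    rw [opA, lTwoRepr_bilaplacian hu, hx]
    simp [Finset.smul_sum]
  have h1 : ∀ i ∈ (Finset.univ : Finset (Fin N)), AEStronglyMeasurable (∑ j, fun x =>
      (diffusion α x ^ 2 : ℝ) • weakPartial [i, i, j, j] u x) volume := fun i _ =>
    Finset.aestronglyMeasurable_sum _ fun j _ => aestronglyMeasurable_diffusion_smul α _
  have h2 : eLpNorm (∑ i, ∑ j, fun x => (diffusion α x ^ 2 : ℝ) • weakPartial [i, i, j, j] u x) 2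
      volume ≤ 4 * N ^ 2 * K := by
    refine (eLpNorm_sum_le h1 one_le_two).trans ?_
    calc _ ≤ ∑ i : Fin N, ∑ j : Fin N, 4 * K := by
          refine Finset.sum_le_sum fun i _ => (eLpNorm_sum_le (fun j _ =>
            aestronglyMeasurable_diffusion_smul α _) one_le_two).trans
            (Finset.sum_le_sum fun j _ => ?_)
          exact eLpNorm_diffusion_smul_le α _ u (hK (0, [i, i, j, j]) ⟨by simp, by simp⟩)
            (hK (2 * α, [i, i, j, j]) ⟨by simp, by left; norm_num⟩)
      _ = _ := by simp; ring
  have h3 : eLpNorm (potentialSq β u) 2 volume ≤ K := by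
    rw [eLpNorm_potentialSq]
    exact hK (2 * β, []) ⟨by simp, by simp⟩
  have h4 : eLpNorm u 2 volume ≤ K := by
    have := hK (0, []) ⟨by simp, by simp⟩
    rwa [weightedNorm_zero, weakPartial_nil] at this
  rw [graphNorm, eLpNorm_congr_ae hae]
  calc _ ≤ (4 * N ^ 2 * K + K) + K := by
        refine add_le_add ((eLpNorm_add_le (Finset.aestronglyMeasurable_sum _ h1)
          (aestronglyMeasurable_potentialSq β u) one_le_two).trans (add_le_add h2 h3)) h4
    _ = _ := by ring

theorem graphNorm_le_add {α β : ℝ} {u v : LTwo N} (hu : MemSobolev 4 2 u.toDistr)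
    (hv : MemSobolev 4 2 v.toDistr) :
    graphNorm α β v ≤ graphNorm α β u + graphNorm α β (u - v) := by
  have huv : MemSobolev 4 2 (u - v).toDistr := by
    rw [LTwo.toDistr_sub]; exact hu.sub hv
  have h0 : lTwoRepr (Δ (Δ (u - v).toDistr)) =
      lTwoRepr (Δ (Δ u.toDistr)) - lTwoRepr (Δ (Δ v.toDistr)) := by
    simp_rw [lTwoRepr_bilaplacian huv, lTwoRepr_bilaplacian hu, lTwoRepr_bilaplacian hv,
      ← Finset.sum_sub_distrib]
    exact Finset.sum_congr rfl fun i _ => Finset.sum_congr rfl fun j _ =>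
      weakPartial_sub (by simp) hu hv
  have hs := Lp.coeFn_sub u v
  have hae : opA α β v =ᵐ[volume] opA α β u - opA α β (u - v) := by
    filter_upwards [hs, Lp.coeFn_sub (lTwoRepr (Δ (Δ u.toDistr))) (lTwoRepr (Δ (Δ v.toDistr)))]
      with x hx1 hx2
    rw [Pi.sub_apply, opA, opA, opA, potentialSq, potentialSq, potentialSq, h0, hx1, hx2,
      Pi.sub_apply, Pi.sub_apply, smul_sub, smul_sub]
    ring
  have hae' : v =ᵐ[volume] u - (u - v : LTwo N) := by
    filter_upwards [hs] with x hx
    rw [Pi.sub_apply, hx, Pi.sub_apply, sub_sub_cancel]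
  rw [graphNorm, eLpNorm_congr_ae hae, eLpNorm_congr_ae hae', graphNorm, graphNorm,
    add_add_add_comm]
  exact add_le_add (eLpNorm_sub_le (aestronglyMeasurable_opA α β u)
    (aestronglyMeasurable_opA α β _) one_le_two) (eLpNorm_sub_le (Lp.aestronglyMeasurable u)
    (Lp.aestronglyMeasurable _) one_le_two)

theorem weightedNorm_le_add {s : ℝ} {l : List (Fin N)} (hl : l.length ≤ 4) {u v : LTwo N}
    (hu : MemSobolev 4 2 u.toDistr) (hv : MemSobolev 4 2 v.toDistr) :
    weightedNorm s l u ≤ weightedNorm s l v + weightedNorm s l (u - v) := by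
  have hm : ∀ z : LTwo N, AEStronglyMeasurable (fun x => ‖x‖ ^ s • weakPartial l z x) volume :=
    fun z => (aestronglyMeasurable_norm_rpow s).smul (Lp.aestronglyMeasurable _)
  refine (eLpNorm_congr_ae ?_).trans_le (eLpNorm_add_le (hm v) (hm (u - v)) one_le_two)
  rw [weakPartial_sub hl hu hv]
  filter_upwards [Lp.coeFn_sub (weakPartial l u) (weakPartial l v)] with x hx
  rw [Pi.add_apply, hx, Pi.sub_apply, smul_sub, add_sub_cancel]

/-! ### The domain of the operator -/

theorem aestronglyMeasurable_weightedDeriv (α : ℝ) (h : ℕ) (u : LTwo N) :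
    AEStronglyMeasurable (weightedDeriv α h u) volume := by
  have hm : ∀ m : Fin (4 - h) → Fin N, AEStronglyMeasurable
      (fun x => ‖lTwoRepr (distribPartial m u.toDistr) x‖ ^ 2) volume :=
    fun m => (Lp.aestronglyMeasurable _).norm.pow 2
  refine (aestronglyMeasurable_norm_rpow _).mul
    (Real.continuous_sqrt.comp_aestronglyMeasurable ?_)
  exact Finset.aestronglyMeasurable_fun_sum _ fun m _ => hm m

theorem eLpNorm_weightedDeriv_le (hN : 0 < N) {α β : ℝ} {h : ℕ} (hh : h ≤ 4) {u : LTwo N}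
    {K : ℝ≥0∞} (hK : ∀ p ∈ graphIndex N α β, weightedNorm p.1 p.2 u ≤ K) :
    eLpNorm (weightedDeriv α h u) 2 volume ≤ N ^ 4 * K := by
  have hm : ∀ m : Fin (4 - h) → Fin N, AEStronglyMeasurable
      (fun x => ‖‖x‖ ^ (2 * α - h) • weakPartial (List.ofFn m) u x‖) volume := fun m =>
    ((aestronglyMeasurable_norm_rpow _).smul (Lp.aestronglyMeasurable _)).norm
  calc _ ≤ eLpNorm (∑ m : Fin (4 - h) → Fin N, fun x =>
        ‖‖x‖ ^ (2 * α - h) • weakPartial (List.ofFn m) u x‖) 2 volume := by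
        refine eLpNorm_mono_real fun x => ?_
        have hx : 0 ≤ ‖x‖ ^ (2 * α - h) := by positivity
        rw [weightedDeriv, absDeriv, Real.norm_of_nonneg (by positivity), Finset.sum_apply]
        simp only [norm_smul, Real.norm_of_nonneg hx]
        rw [← Finset.mul_sum]
        refine mul_le_mul_of_nonneg_left (Real.sqrt_le_iff.2 ⟨by positivity, ?_⟩) hx
        simp only [distribPartial_eq_distPartial]
        exact Finset.sum_sq_le_sq_sum_of_nonneg fun _ _ => norm_nonneg _
    _ ≤ ∑ m : Fin (4 - h) → Fin N, K := by
        refine (eLpNorm_sum_le (fun m _ => hm m) one_le_two).trans (Finset.sum_le_sum fun m _ => ?_)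
        rw [eLpNorm_norm]
        refine hK (2 * α - h, List.ofFn m) ⟨by simp, Or.inl ?_⟩
        rw [List.length_ofFn, Nat.cast_sub hh]
        push_cast
        ring
    _ ≤ N ^ 4 * K := by
        rw [Finset.sum_const, nsmul_eq_mul]
        gcongr
        simp only [Finset.card_univ, Fintype.card_fun, Fintype.card_fin]
        exact_mod_cast Nat.pow_le_pow_right hN (Nat.sub_le 4 h)

theorem weightedNorm_le_eLpNorm_weightedDeriv (α : ℝ) {h : ℕ} {l : List (Fin N)}
    (hl : l.length = 4 - h) (u : LTwo N) :
    weightedNorm (2 * α - h) l u ≤ eLpNorm (weightedDeriv α h u) 2 volume := by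
  refine eLpNorm_mono_real fun x => ?_
  have hx : 0 ≤ ‖x‖ ^ (2 * α - h) := by positivity
  rw [norm_smul, Real.norm_of_nonneg hx, weightedDeriv, absDeriv]
  refine mul_le_mul_of_nonneg_left (Real.le_sqrt_of_sq_le ?_) hx
  rw [← hl]
  have := Finset.single_le_sum (f := fun m : Fin l.length → Fin N =>
    ‖lTwoRepr (distribPartial m u.toDistr) x‖ ^ 2) (fun _ _ => sq_nonneg _) (Finset.mem_univ l.get)
  rwa [distribPartial_eq_distPartial, List.ofFn_get] at this

theorem mem_domainTwo_of_weightedNorm_le (hN : 0 < N) {α β : ℝ} {u : LTwo N}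
    (hu : MemSobolev 4 2 u.toDistr) {K : ℝ≥0∞} (hK0 : K < ⊤)
    (hK : ∀ p ∈ graphIndex N α β, weightedNorm p.1 p.2 u ≤ K) : u ∈ domainTwo N α β := by
  refine ⟨hu, ⟨aestronglyMeasurable_potentialSq β u, ?_⟩, fun h hh =>
    ⟨aestronglyMeasurable_weightedDeriv α h u, ?_⟩⟩
  · rw [eLpNorm_potentialSq]
    exact (hK (2 * β, []) ⟨by simp, by simp⟩).trans_lt hK0
  · refine (eLpNorm_weightedDeriv_le hN hh hK).trans_lt ?_
    exact ENNReal.mul_lt_top (by simp) hK0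

/-- For `u` in the domain, the weighted norms which appear when `D_l u` is truncated are finite;
for the unweighted fourth order derivatives this is Hardy's inequality. -/
theorem weightedNorm_lt_top (hN : 8 < N) {α β : ℝ} {u : LTwo N} (hu : u ∈ domainTwo N α β)
    {p : ℝ × List (Fin N)} (hp : p ∈ graphIndex N α β) {b : List (Fin N)}
    (hb : b.length ≤ p.2.length) : weightedNorm (p.1 - p.2.length + b.length) b u < ⊤ := by
  obtain ⟨hu1, hu2, hu3⟩ := hu
  obtain ⟨s, l⟩ := p
  obtain ⟨hl, h | ⟨h, h4⟩ | ⟨h, h4⟩⟩ := hp <;> dsimp only at *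
  · have hb4 : b.length ≤ 4 := hb.trans hl
    have e : s - l.length + b.length = 2 * α - ((4 - b.length : ℕ) : ℝ) := by
      rw [h, Nat.cast_sub hb4]; push_cast; ring
    rw [e]
    exact (weightedNorm_le_eLpNorm_weightedDeriv α (by omega) u).trans_lt (hu3 _ (by omega)).2
  · have e : s - l.length + b.length = (b.length : ℝ) - 4 := by
      rw [h, h4]; push_cast; ring
    have hfin := List.finite_length_eq (Fin N) 4
    rw [e]
    refine (weightedNorm_le_of_norm_le hN hu1 (hb.trans hl)
      (K := ∑ m ∈ hfin.toFinset, ‖weakPartial m u‖) (by positivity) fun m hm => ?_).trans_lt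
      ENNReal.ofReal_lt_top
    exact Finset.single_le_sum (f := fun m => ‖weakPartial m u‖) (fun _ _ => norm_nonneg _)
      (hfin.mem_toFinset.2 hm)
  · subst h4
    have hb0 : b = [] := List.eq_nil_of_length_eq_zero (Nat.le_zero.1 hb)
    subst hb0
    simp only [List.length_nil, Nat.cast_zero, sub_zero, add_zero]
    rcases h with h | h
    · rw [h, ← eLpNorm_potentialSq]; exact hu2.2
    · rw [h, weightedNorm_zero]; exact Lp.eLpNorm_lt_top _

theorem exists_weightedNorm_le {α β : ℝ} {u : LTwo N}
    (h : ∀ p ∈ graphIndex N α β, weightedNorm p.1 p.2 u < ⊤) :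
    ∃ K : ℝ≥0∞, K < ⊤ ∧ ∀ p ∈ graphIndex N α β, weightedNorm p.1 p.2 u ≤ K := by
  have hf := finite_graphIndex N α β
  refine ⟨∑ p ∈ hf.toFinset, weightedNorm p.1 p.2 u,
    ENNReal.sum_lt_top.2 fun p hp => h p (hf.mem_toFinset.1 hp), fun p hp => ?_⟩
  exact Finset.single_le_sum (f := fun p : ℝ × List (Fin N) => weightedNorm p.1 p.2 u)
    (fun _ _ => zero_le) (hf.mem_toFinset.2 hp)

theorem memLp_opA (hN : 8 < N) {α β : ℝ} {u : LTwo N} (hu : u ∈ domainTwo N α β) :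
    MemLp (opA α β u) 2 volume := by
  obtain ⟨K, hK, hle⟩ := exists_weightedNorm_le (α := α) (β := β) (u := u) fun p hp => by
    simpa using weightedNorm_lt_top hN hu hp le_rfl
  refine ⟨aestronglyMeasurable_opA α β u, ?_⟩
  refine (le_self_add.trans (graphNorm_le hu.1 hle)).trans_lt (ENNReal.mul_lt_top ?_ hK)
  exact_mod_cast ENNReal.natCast_lt_top (4 * N ^ 2 + 2)

theorem IsTest.toLp_mem_domainTwo (hN : 0 < N) {f : 𝓢(EuclideanSpace ℝ (Fin N), ℂ)}
    (hf : IsTest f) (α β : ℝ) : f.toLp 2 volume ∈ domainTwo N α β := by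
  obtain ⟨K, hK, hle⟩ := exists_weightedNorm_le (α := α) (β := β) (u := f.toLp 2 volume)
    fun p _ => by rw [hf.weightedNorm_eq]; exact ENNReal.ofReal_lt_top
  exact mem_domainTwo_of_weightedNorm_le hN (memSobolev_toLp f 4) hK hle

theorem IsTest.toLp_mem_testFunctions {f : 𝓢(EuclideanSpace ℝ (Fin N), ℂ)} (hf : IsTest f) :
    f.toLp 2 volume ∈ testFunctions N :=
  ⟨f, f.smooth ⊤, hf.1, hf.2, f.coeFn_toLp 2 volume⟩

theorem exists_isTest_of_mem_testFunctions {u : LTwo N} (hu : u ∈ testFunctions N) :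
    ∃ f : 𝓢(EuclideanSpace ℝ (Fin N), ℂ), IsTest f ∧ u = f.toLp 2 volume := by
  obtain ⟨φ, hφ, hc, h0, hae⟩ := hu
  refine ⟨hc.toSchwartzMap hφ, ⟨hc, h0⟩, Lp.ext ?_⟩
  exact hae.trans ((hc.toSchwartzMap hφ).coeFn_toLp 2 volume).symm

/-- The a priori estimates for test functions. -/
theorem exists_weightedNorm_toLp_le (hN : 8 < N) {α β : ℝ} (hα : 0 < α)
    (hβ : max (α - 2) 0 < β) : ∃ C : ℝ≥0, ∀ f : 𝓢(EuclideanSpace ℝ (Fin N), ℂ), IsTest f →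
      ∀ p ∈ graphIndex N α β, weightedNorm p.1 p.2 (f.toLp 2 volume) ≤
        C * graphNorm α β (f.toLp 2 volume) := by
  obtain ⟨C, hC0, hC⟩ := exists_test_estimate hN hα hβ
  refine ⟨(√(C + 1)).toNNReal, fun f hf p hp => ?_⟩
  obtain ⟨hC1, hC2, hC3⟩ := hC f hf
  have hE0 : 0 ≤ powerEnergy 0 f := powerEnergy_nonneg _ _
  have hA0 : 0 ≤ opEnergy α β f := integral_nonneg fun x => by positivity
  have hae : opA α β (f.toLp 2 volume) =ᵐ[volume] fun x =>
      (1 + ‖x‖ ^ α) ^ 2 • Δ (Δ f) x + (‖x‖ ^ β) ^ 2 • f x := by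
    filter_upwards [f.coeFn_toLp 2 volume, (Δ (Δ f)).coeFn_toLp 2 volume] with x hx1 hx2
    rw [opA, lTwoRepr_bilaplacian_toLp, hx2, potentialSq, hx1]
    rfl
  have hA : eLpNorm (opA α β (f.toLp 2 volume)) 2 volume = ENNReal.ofReal √(opEnergy α β f) := by
    rw [eLpNorm_two_eq_sqrt_integral (memLp_opA hN (hf.toLp_mem_domainTwo (by omega) α β)), opEnergy]
    congr 2
    refine integral_congr_ae ?_
    filter_upwards [hae] with x hx
    rw [hx]
  have hE : eLpNorm (f.toLp 2 volume) 2 volume = ENNReal.ofReal √(powerEnergy 0 f) := by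
    have := hf.weightedNorm_eq 0 []
    rwa [weightedNorm_zero, weakPartial_nil, mul_zero] at this
  have key : powerEnergy (2 * p.1) (schPartial p.2 f) ≤
      (C + 1) * (opEnergy α β f + powerEnergy 0 f) := by
    obtain ⟨s, l⟩ := p
    obtain ⟨hl, h | ⟨h, h4⟩ | ⟨h, h4⟩⟩ := hp <;> dsimp only at *
    · have h1 := powerEnergy_le_derivEnergy l.length (4 * α - 2 * (4 - l.length)) f rfl
      have h2 := hC1 _ hl
      rw [h, show 2 * (2 * α - (4 - (l.length : ℝ))) = 4 * α - 2 * (4 - l.length) by ring]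
      linarith
    · have h1 := powerEnergy_le_derivEnergy 4 0 f h4
      rw [h, mul_zero]
      linarith
    · rw [h4, schPartial_nil]
      rcases h with h | h
      · rw [h, ← mul_assoc, show (2 : ℝ) * 2 = 4 by norm_num]
        linarith
      · rw [h, mul_zero]
        nlinarith
  have hsqrt : √(opEnergy α β f + powerEnergy 0 f) ≤ √(opEnergy α β f) + √(powerEnergy 0 f) := by
    refine Real.sqrt_le_iff.2 ⟨by positivity, ?_⟩
    nlinarith [Real.sq_sqrt hA0, Real.sq_sqrt hE0, Real.sqrt_nonneg (opEnergy α β f),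
      Real.sqrt_nonneg (powerEnergy 0 f), mul_nonneg (Real.sqrt_nonneg (opEnergy α β f))
        (Real.sqrt_nonneg (powerEnergy 0 f))]
  rw [hf.weightedNorm_eq, graphNorm, hA, hE, ← ENNReal.ofReal_add (Real.sqrt_nonneg _)
    (Real.sqrt_nonneg _), ← ENNReal.ofReal, ← ENNReal.ofReal_mul (Real.sqrt_nonneg _)]
  refine ENNReal.ofReal_le_ofReal ((Real.sqrt_le_sqrt key).trans ?_)
  rw [Real.sqrt_mul (by positivity)]
  gcongr

/-- The a priori estimates pass from test functions to the domain by approximation. -/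
theorem weightedNorm_le_graphNorm (hN : 8 < N) {α β : ℝ} {C : ℝ≥0}
    (hC : ∀ f : 𝓢(EuclideanSpace ℝ (Fin N), ℂ), IsTest f →
      ∀ p ∈ graphIndex N α β, weightedNorm p.1 p.2 (f.toLp 2 volume) ≤
        C * graphNorm α β (f.toLp 2 volume))
    {u : LTwo N} (hu : u ∈ domainTwo N α β) {p : ℝ × List (Fin N)}
    (hp : p ∈ graphIndex N α β) : weightedNorm p.1 p.2 u ≤ C * graphNorm α β u := by
  set c : ℝ≥0 := 4 * N ^ 2 + 2
  refine ENNReal.le_of_forall_pos_le_add fun δ hδ _ => ?_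
  set ε : ℝ≥0 := δ / (C * c + 1) with hε
  have hε0 : 0 < ε := by positivity
  obtain ⟨f, hf, hfε⟩ := exists_test_weightedNorm_sub_lt (by omega) hu.1 (finite_graphIndex N α β)
    (fun p hp => hp.1) (fun p hp b hb => weightedNorm_lt_top hN hu hp hb)
    (ε := ε) (by exact_mod_cast hε0)
  have huf : MemSobolev 4 2 (u - f.toLp 2 volume).toDistr := by
    rw [LTwo.toDistr_sub]; exact hu.1.sub (memSobolev_toLp f 4)
  calc weightedNorm p.1 p.2 u
      ≤ weightedNorm p.1 p.2 (f.toLp 2 volume) + weightedNorm p.1 p.2 (u - f.toLp 2 volume) :=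
        weightedNorm_le_add hp.1 hu.1 (memSobolev_toLp f 4)
    _ ≤ C * graphNorm α β (f.toLp 2 volume) + ε := add_le_add (hC f hf p hp) (hfε p hp).le
    _ ≤ C * (graphNorm α β u + c * ε) + ε := by
        gcongr
        refine (graphNorm_le_add hu.1 (memSobolev_toLp f 4)).trans (add_le_add le_rfl ?_)
        rw [show (c : ℝ≥0∞) = 4 * N ^ 2 + 2 by simp [c]]
        exact graphNorm_le huf fun p hp => (hfε p hp).le
    _ = C * graphNorm α β u + ((C * c + 1) * ε : ℝ≥0) := by push_cast; ring
    _ = C * graphNorm α β u + δ := by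
        rw [hε, mul_div_cancel₀ _ (by positivity)]

end

theorem proposition3p4 (N : ℕ) (hN : 8 < N) (α β : ℝ) (hα : 0 < α)
    (hβ : max (α - 2) 0 < β) :
    -- the test functions and `A u` for `u ∈ D₂(A)` lie where they should
    testFunctions N ⊆ domainTwo N α β ∧
    (∀ u ∈ domainTwo N α β, MemLp (opA α β u) 2 volume) ∧
    -- density for the graph norm
    (∀ u ∈ domainTwo N α β, ∀ ε : ℝ≥0∞, 0 < ε →
      ∃ φ ∈ testFunctions N, graphNorm α β (u - φ) < ε) ∧
    -- a priori estimates
    ∃ C : ℝ≥0, ∀ u ∈ domainTwo N α β,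
      (∀ h : ℕ, h ≤ 4 →
        eLpNorm (weightedDeriv α h u) 2 volume ≤ C * graphNorm α β u) ∧
      eLpNorm (potentialSq β u) 2 volume ≤ C * graphNorm α β u := by
  have hN0 : 0 < N := by omega
  refine ⟨fun u hu => ?_, fun u hu => memLp_opA hN hu, fun u hu ε hε => ?_, ?_⟩
  · obtain ⟨f, hf, rfl⟩ := exists_isTest_of_mem_testFunctions hu
    exact hf.toLp_mem_domainTwo hN0 α β
  · obtain ⟨δ, hδ0, hδ⟩ := ENNReal.lt_iff_exists_nnreal_btwn.1 hε
    have hδ0' : 0 < δ := by exact_mod_cast hδ0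
    have hη : 0 < δ / (4 * (N : ℝ≥0) ^ 2 + 2) := by positivity
    obtain ⟨f, hf, hfε⟩ := exists_test_weightedNorm_sub_lt hN0 hu.1 (finite_graphIndex N α β)
      (fun p hp => hp.1) (fun p hp b hb => weightedNorm_lt_top hN hu hp hb)
      (ε := (δ / (4 * (N : ℝ≥0) ^ 2 + 2) : ℝ≥0)) (by exact_mod_cast hη)
    have huf : MemSobolev 4 2 (u - f.toLp 2 volume).toDistr := by
      rw [LTwo.toDistr_sub]; exact hu.1.sub (memSobolev_toLp f 4)
    refine ⟨f.toLp 2 volume, hf.toLp_mem_testFunctions, ?_⟩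
    refine (graphNorm_le huf fun p hp => (hfε p hp).le).trans_lt (lt_of_eq_of_lt ?_ hδ)
    have e : (4 * (N : ℝ≥0) ^ 2 + 2) * (δ / (4 * (N : ℝ≥0) ^ 2 + 2)) = δ :=
      mul_div_cancel₀ _ (by positivity)
    exact_mod_cast congrArg ((↑) : ℝ≥0 → ℝ≥0∞) e
  · obtain ⟨C, hC⟩ := exists_weightedNorm_toLp_le hN hα hβ
    refine ⟨N ^ 4 * C, fun u hu => ⟨fun h hh => ?_, ?_⟩⟩
    · have := eLpNorm_weightedDeriv_le hN0 hh fun p hp => weightedNorm_le_graphNorm hN hC hu hp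
      rw [← mul_assoc] at this
      exact_mod_cast this
    · rw [eLpNorm_potentialSq]
      refine (weightedNorm_le_graphNorm hN hC hu
        (p := (2 * β, [])) ⟨by simp, by simp⟩).trans ?_
      gcongr
      exact le_mul_of_one_le_left zero_le (one_le_pow₀ (by exact_mod_cast hN0))
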